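/- Let $(M,\mathcal C)$ be a countable transitive model of Morse--Kelley class theory: $M$ is a countable transitive set, $\mathcal C$ is a countable family of subsets of $M$ (the classes), and $(M,\in,\mathcal C)$ satisfies extensionality, pairing, infinity, union and power set for sets, and foundation, extensionality, replacement, comprehension for all second-order formulas (with parameters), and global choice for classes. Let $P\in\mathcal C$ and let $\le\ \in\mathcal C$ be a partial order on $P$ with a greatest element. Generics. $G\subseteq P$ is $P$-generic over $(M,\mathcal C)$ if any two elements of $G$ have a common lower bound in $P$, $G$ is upwards closed in $P$, and $G\cap D\ne\emptyset$ for every dense $D\subseteq P$ with $D\in\mathcal C$. Names. Put $\mathcal N^s_0=\emptyset$, $\mathcal N^s_{\alpha+1}=\{\sigma\in M:\sigma\subseteq\mathcal N^s_\alpha\times P\}$, $\mathcal N^s_\lambda=\bigcup_{\alpha<\lambda}\mathcal N^s_\alpha$ for limit $\lambda$. The set-names are the elements of $\mathcal N^s=\bigcup_{\alpha\in \mathrm{Ord}(M)}\mathcal N^s_\alpha$, and the class-names are the elements of $\mathcal N=\{\Sigma\in\mathcal C:\Sigma\subseteq\mathcal N^s\times P\}$. For a name $\Sigma$ of either kind,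 $\Sigma^G=\{\tau^G:\exists p\in G\ \langle\tau,p\rangle\in\Sigma\}$ (recursively), and $(M,\mathcal C)[G]=(\{\sigma^G:\sigma\in\mathcal N^s\},\{\Sigma^G:\Sigma\in\mathcal N\})$. Formulas are those of the two-sorted language with set and class variables, built from the atomic formulas $u\in w$ and $u=w$ ($u,w$ variables of either sort) by $\wedge$, $\neg$, $\forall x$ (over sets) and $\forall X$ (over classes); $\varphi\leftrightarrow\psi$ abbreviates $\neg(\varphi\wedge\neg\psi)\wedge\neg(\psi\wedge\neg\varphi)$. Semantic forcing. $p\Vdash\varphi(\sigma_1,\dots,\sigma_m,\Sigma_1,\dots,\Sigma_n)$ iff for every $P$-generic $G$ over $(M,\mathcal C)$ with $p\in G$ we have $(M,\mathcal C)[G]\models\varphi(\sigma_1^G,\dots,\sigma_m^G,\Sigma_1^G,\dots,\Sigma_n^G)$. Syntactic forcing. $\Vdash^*$ is defined recursively as follows, where $\Sigma,\Gamma$ are names of either kind in the first two clauses, and $D$ is dense below $p$ if $\forall q\le p\,\exists r\le q\ (r\in D)$: - $p\Vdash^*\Sigma\in\Gamma$ iff $\{q:\exists\langle\pi,r\rangle\in\Gamma\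 (q\le r\text{ and }q\Vdash^*\pi=\Sigma)\}$ is dense below $p$; - $p\Vdash^*\Sigma=\Gamma$ iff $p\Vdash^*(\pi\in\Sigma\leftrightarrow\pi\in\Gamma)$ for all $\langle\pi,r\rangle\in\Sigma\cup\Gamma$; - $p\Vdash^*\varphi\wedge\psi$ iff $p\Vdash^*\varphi$ and $p\Vdash^*\psi$; - $p\Vdash^*\neg\varphi$ iff there is no $q\le p$ with $q\Vdash^*\varphi$; - $p\Vdash^*\forall x\,\varphi$ iff $p\Vdash^*\varphi(\sigma)$ for all $\sigma\in\mathcal N^s$; - $p\Vdash^*\forall X\,\varphi$ iff $p\Vdash^*\varphi(\Sigma)$ for all $\Sigma\in\mathcal N$. Then $\Vdash^*$ and $\Vdash$ coincide: for every formula $\varphi(x_1,\dots,x_m,X_1,\dots,X_n)$, all $\sigma_1,\dots,\sigma_m\in\mathcal N^s$, all $\Sigma_1,\dots,\Sigma_n\in\mathcal N$ and every $p\in P$, $$p\Vdash^*\varphi(\sigma_1,\dots,\sigma_m,\Sigma_1,\dots,\Sigma_n)\iff p\Vdash\varphi(\sigma_1,\dots,\sigma_m,\Sigma_1,\dots,\Sigma_n).$$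 -/

import Mathlib

universe u

namespace ClassForcing

/-! ### The two-sorted second-order language of class theory -/

/-- Variables: `set n` is the set variable `xₙ`, `cls n` is the class variable `Xₙ`. -/
inductive Var : Type
  | set : ℕ → Var
  | cls : ℕ → Var
  deriving DecidableEq

/-- Second-order formulas, with quantification over sets and over classes. -/
inductive Formula : Type
  | mem : Var → Var → Formula
  | eq : Var → Var → Formula
  | and : Formula → Formula → Formula
  | neg : Formula → Formula
  | allSet : ℕ → Formula → Formula
  | allCls : ℕ → Formula → Formula

/-- `v` sends set variables into `A` and class variables into `B`. -/
def IsAssignment (A B : Set ZFSet.{u}) (v : Var → ZFSet.{u}) : Prop :=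
  (∀ n, v (.set n) ∈ A) ∧ (∀ n, v (.cls n) ∈ B)

/-- Satisfaction in the two-sorted structure `(M, C)` with the true membership relation. -/
def Sat (M C : Set ZFSet.{u}) : Formula → (Var → ZFSet.{u}) → Prop
  | .mem a b, v => v a ∈ v b
  | .eq a b, v => v a = v b
  | .and φ ψ, v => Sat M C φ v ∧ Sat M C ψ v
  | .neg φ, v => ¬ Sat M C φ v
  | .allSet n φ, v => ∀ x ∈ M, Sat M C φ (Function.update v (.set n) x)
  | .allCls n φ, v => ∀ X ∈ C, Sat M C φ (Function.update v (.cls n) X)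

/-! ### Models of Morse-Kelley class theory -/

/-- `(M, C)` is a transitive model of Morse-Kelley class theory: `M` is transitive, the classes in
`C` are subsets of `M`, and the axioms of `MK` hold in the structure `(M, ∈, C)`. -/
structure IsMKModel (M C : Set ZFSet.{u}) : Prop where
  transitive : ∀ x ∈ M, ∀ y ∈ x, y ∈ M
  subset : ∀ X ∈ C, ∀ x ∈ X, x ∈ M
  -- set axioms
  extensionality : ∀ x ∈ M, ∀ y ∈ M, (∀ z ∈ M, z ∈ x ↔ z ∈ y) → x = y
  pairing : ∀ x ∈ M, ∀ y ∈ M, ∃ z ∈ M, ∀ w ∈ M, w ∈ z ↔ w = x ∨ w = y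
  infinity : ∃ x ∈ M, (x : Set ZFSet.{u}).Infinite
  union : ∀ x ∈ M, ∃ z ∈ M, ∀ w ∈ M, w ∈ z ↔ ∃ y ∈ x, w ∈ y
  powerset : ∀ x ∈ M, ∃ z ∈ M, ∀ w ∈ M, w ∈ z ↔ w ⊆ x
  -- class axioms
  foundation : ∀ X ∈ C, (∃ x, x ∈ X) → ∃ x ∈ X, ∀ y ∈ X, y ∉ x
  extensionality_cls : ∀ X ∈ C, ∀ Y ∈ C, (∀ z ∈ M, z ∈ X ↔ z ∈ Y) → X = Y
  replacement : ∀ F ∈ C, (∀ w ∈ F, ∃ z y, w = ZFSet.pair z y) →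
    (∀ z y y', ZFSet.pair z y ∈ F → ZFSet.pair z y' ∈ F → y = y') →
    ∀ x ∈ M, ∃ r ∈ M, ∀ y ∈ M, y ∈ r ↔ ∃ z ∈ x, ZFSet.pair z y ∈ F
  comprehension : ∀ (φ : Formula) (n : ℕ) (v : Var → ZFSet.{u}), IsAssignment M C v →
    ∃ Y ∈ C, ∀ x ∈ M, x ∈ Y ↔ Sat M C φ (Function.update v (.set n) x)
  global_choice : ∃ R ∈ C,
    (∀ x ∈ M, ZFSet.pair x x ∉ R) ∧
    (∀ x ∈ M, ∀ y ∈ M, ∀ z ∈ M, ZFSet.pair x y ∈ R → ZFSet.pair y z ∈ R → ZFSet.pair x z ∈ R) ∧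
    (∀ x ∈ M, ∀ y ∈ M, ZFSet.pair x y ∈ R ∨ x = y ∨ ZFSet.pair y x ∈ R) ∧
    (∀ X ∈ C, (∃ x, x ∈ X) → ∃ x ∈ X, ∀ y ∈ X, y = x ∨ ZFSet.pair x y ∈ R)

/-! ### Forcing notions and generic filters -/

/-- `(P, le)` is an `(M, C)`-forcing: `P, le ∈ C` and `le` is a partial order on `P` with a greatest
element; `ZFSet.pair q p ∈ le` means `q ≤ p`. -/
structure IsForcing (C : Set ZFSet.{u}) (P le : ZFSet.{u}) : Prop where
  carrier_mem : P ∈ C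
  le_mem : le ∈ C
  le_subset : le ⊆ P.prod P
  refl : ∀ p ∈ P, ZFSet.pair p p ∈ le
  trans : ∀ p q r, ZFSet.pair p q ∈ le → ZFSet.pair q r ∈ le → ZFSet.pair p r ∈ le
  antisymm : ∀ p q, ZFSet.pair p q ∈ le → ZFSet.pair q p ∈ le → p = q
  exists_greatest : ∃ one ∈ P, ∀ p ∈ P, ZFSet.pair p one ∈ le

/-- `D` is a dense subclass of `P`. -/
def IsDense (P le D : ZFSet.{u}) : Prop :=
  D ⊆ P ∧ ∀ p ∈ P, ∃ q ∈ D, ZFSet.pair q p ∈ le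

/-- `G ⊆ P` is `P`-generic over `(M, C)`. -/
structure IsGeneric (C : Set ZFSet.{u}) (P le G : ZFSet.{u}) : Prop where
  subset : G ⊆ P
  compatible : ∀ p ∈ G, ∀ q ∈ G, ∃ r ∈ P, ZFSet.pair r p ∈ le ∧ ZFSet.pair r q ∈ le
  upward_closed : ∀ p ∈ P, ∀ q ∈ G, ZFSet.pair q p ∈ le → p ∈ G
  meets_dense : ∀ D ∈ C, IsDense P le D → ∃ p ∈ G, p ∈ D

/-! ### Names -/

/-- The `α`-th level of the hierarchy of set-names: `∅` at `0`, the subsets in `M` of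
(previous level) `× P` at successors, unions at limits. -/
noncomputable def setNamesAt (M : Set ZFSet.{u}) (P : ZFSet.{u}) (α : Ordinal.{u}) :
    Set ZFSet.{u} :=
  Ordinal.limitRecOn α ∅
    (fun _ N => {σ | σ ∈ M ∧ ∀ x ∈ σ, ∃ π ∈ N, ∃ r ∈ P, x = ZFSet.pair π r})
    (fun l _ N => {σ | ∃ β, ∃ h : β < l, σ ∈ N β h})

/-- The set-names: the union of the levels indexed by the ordinals of `M`. -/
def setNames (M : Set ZFSet.{u}) (P : ZFSet.{u}) : Set ZFSet.{u} :=
  {σ | ∃ α : Ordinal.{u}, α.toZFSet ∈ M ∧ σ ∈ setNamesAt M P α}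

/-- The class-names: the subclasses of (set-names) `× P` in `C`. -/
def classNames (M C : Set ZFSet.{u}) (P : ZFSet.{u}) : Set ZFSet.{u} :=
  {S | S ∈ C ∧ ∀ x ∈ S, ∃ π ∈ setNames M P, ∃ r ∈ P, x = ZFSet.pair π r}

theorem rank_lt_of_pair_mem {τ p σ : ZFSet.{u}} (h : ZFSet.pair τ p ∈ σ) : τ.rank < σ.rank := by
  have h1 : ({τ} : ZFSet.{u}) ∈ ZFSet.pair τ p := by simp [ZFSet.pair]
  have h2 : τ ∈ ({τ} : ZFSet.{u}) := by simp
  exact (ZFSet.rank_lt_of_mem h2).trans ((ZFSet.rank_lt_of_mem h1).trans (ZFSet.rank_lt_of_mem h))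

/-- The set of all `τ` with `⟨τ, p⟩ ∈ σ` for some `p ∈ G`. -/
noncomputable def active (G σ : ZFSet.{u}) : ZFSet.{u} :=
  ZFSet.sep (fun τ => ∃ p ∈ G, ZFSet.pair τ p ∈ σ) (ZFSet.sUnion (ZFSet.sUnion σ))

theorem mem_active {G σ τ : ZFSet.{u}} : τ ∈ active G σ ↔ ∃ p ∈ G, ZFSet.pair τ p ∈ σ := by
  simp only [active, ZFSet.mem_sep, and_iff_right_iff_imp]
  rintro ⟨p, -, hp⟩
  exact ZFSet.mem_sUnion.2 ⟨{τ}, ZFSet.mem_sUnion.2 ⟨_, hp, by simp [ZFSet.pair]⟩,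
    ZFSet.mem_singleton.2 rfl⟩

/-- The interpretation `σ^G = {τ^G : ∃ p ∈ G, ⟨τ, p⟩ ∈ σ}`, for set-names and class-names alike. -/
noncomputable def interp (G σ : ZFSet.{u}) : ZFSet.{u} :=
  ZFSet.range (fun τ : {x : ZFSet.{u} // x ∈ active G σ} => interp G τ.1)
termination_by σ.rank
decreasing_by
  obtain ⟨p, -, hp⟩ := mem_active.1 τ.2
  exact rank_lt_of_pair_mem hp

theorem mem_interp {G σ x : ZFSet.{u}} :
    x ∈ interp G σ ↔ ∃ τ, (∃ p ∈ G, ZFSet.pair τ p ∈ σ) ∧ interp G τ = x := by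
  rw [interp, ZFSet.mem_range]
  constructor
  · rintro ⟨⟨τ, hτ⟩, rfl⟩
    exact ⟨τ, mem_active.1 hτ, rfl⟩
  · rintro ⟨τ, hτ, rfl⟩
    exact ⟨⟨τ, mem_active.2 hτ⟩, rfl⟩

/-- The sets `M[G]` of the extension. -/
def extSets (M : Set ZFSet.{u}) (P G : ZFSet.{u}) : Set ZFSet.{u} :=
  {x | ∃ σ ∈ setNames M P, x = interp G σ}

/-- The classes `C[G]` of the extension. -/
def extClasses (M C : Set ZFSet.{u}) (P G : ZFSet.{u}) : Set ZFSet.{u} :=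
  {X | ∃ S ∈ classNames M C P, X = interp G S}

/-! ### The semantic forcing relation -/

/-- `p ⊩ φ(v)`: for every generic `G` containing `p`, the extension `(M, C)[G]` satisfies `φ` at the
interpretations of the names that `v` assigns to the variables. -/
def Forces (M C : Set ZFSet.{u}) (P le : ZFSet.{u}) (φ : Formula) (v : Var → ZFSet.{u})
    (p : ZFSet.{u}) : Prop :=
  ∀ G : ZFSet.{u}, IsGeneric C P le G → p ∈ G →
    Sat (extSets M P G) (extClasses M C P G) φ (fun a => interp G (v a))

/-! ### The syntactic forcing relation

A sentence with names is represented here by the collection of conditions that star-force it. -/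

/-- `D ⊆ P` is dense below `p`. -/
def DenseBelow (le : ZFSet.{u}) (D : ZFSet.{u} → Prop) (p : ZFSet.{u}) : Prop :=
  ∀ q, ZFSet.pair q p ∈ le → ∃ r, ZFSet.pair r q ∈ le ∧ D r

/-- The clause for negation: no `q ≤ p` star-forces `A`. -/
def starNeg (le : ZFSet.{u}) (A : ZFSet.{u} → Prop) (p : ZFSet.{u}) : Prop :=
  ∀ q, ZFSet.pair q p ∈ le → ¬ A q

/-- The clause for conjunction. -/
def starAnd (A B : ZFSet.{u} → Prop) (p : ZFSet.{u}) : Prop :=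
  A p ∧ B p

/-- `A ↔ B` as the abbreviation of `¬(A ∧ ¬B) ∧ ¬(B ∧ ¬A)`. -/
def starIff (le : ZFSet.{u}) (A B : ZFSet.{u} → Prop) : ZFSet.{u} → Prop :=
  starAnd (starNeg le (starAnd A (starNeg le B))) (starNeg le (starAnd B (starNeg le A)))

mutual

/-- `p ⊩* σ ∈ γ` iff `{q : ∃ ⟨π, r⟩ ∈ γ, q ≤ r ∧ q ⊩* π = σ}` is dense below `p`
(for set-names and class-names alike). -/
def StarMem (le σ γ p : ZFSet.{u}) : Prop :=
  DenseBelow le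
    (fun q => ∃ π r, ∃ _ : ZFSet.pair π r ∈ γ, ZFSet.pair q r ∈ le ∧ StarEq le π σ q) p
termination_by (max σ.rank γ.rank, if σ.rank < γ.rank then 0 else 2)
decreasing_by
  have h := rank_lt_of_pair_mem (by assumption)
  by_cases hl : σ.rank < γ.rank
  · exact Prod.Lex.left _ _ (by rw [max_eq_right hl.le]; exact max_lt h hl)
  · have hl' := not_lt.1 hl
    rw [if_neg hl, max_eq_left hl', max_eq_right (h.le.trans hl')]
    exact Prod.Lex.right _ (by norm_num)

/-- `p ⊩* σ = γ` iff `p ⊩* (π ∈ σ ↔ π ∈ γ)` for all `⟨π, r⟩ ∈ σ ∪ γ`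
(for set-names and class-names alike). -/
def StarEq (le σ γ p : ZFSet.{u}) : Prop :=
  ∀ π r, ZFSet.pair π r ∈ σ ∪ γ →
    starIff le (fun q => StarMem le π σ q) (fun q => StarMem le π γ q) p
termination_by (max σ.rank γ.rank, 1)
decreasing_by
  · have h : π.rank < max σ.rank γ.rank := by
      rw [← ZFSet.rank_union]; exact rank_lt_of_pair_mem (by assumption)
    by_cases hl : π.rank < σ.rank
    · rw [if_pos hl, max_eq_right hl.le]
      rcases (le_max_left σ.rank γ.rank).lt_or_eq with h' | h'
      · exact Prod.Lex.left _ _ h'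
      · rw [← h']; exact Prod.Lex.right _ (by norm_num)
    · exact Prod.Lex.left _ _ (by rw [max_eq_left (not_lt.1 hl)]; exact h)
  · have h : π.rank < max σ.rank γ.rank := by
      rw [← ZFSet.rank_union]; exact rank_lt_of_pair_mem (by assumption)
    by_cases hl : π.rank < γ.rank
    · rw [if_pos hl, max_eq_right hl.le]
      rcases (le_max_right σ.rank γ.rank).lt_or_eq with h' | h'
      · exact Prod.Lex.left _ _ h'
      · rw [← h']; exact Prod.Lex.right _ (by norm_num)
    · exact Prod.Lex.left _ _ (by rw [max_eq_left (not_lt.1 hl)]; exact h)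

end

/-- `p ⊩* φ(v)`, where `v` assigns set-names to set variables and class-names to class variables. -/
def ForcesStar (M C : Set ZFSet.{u}) (P le : ZFSet.{u}) :
    Formula → (Var → ZFSet.{u}) → ZFSet.{u} → Prop
  | .mem a b, v => StarMem le (v a) (v b)
  | .eq a b, v => StarEq le (v a) (v b)
  | .and φ ψ, v => starAnd (ForcesStar M C P le φ v) (ForcesStar M C P le ψ v)
  | .neg φ, v => starNeg le (ForcesStar M C P le φ v)
  | .allSet n φ, v => fun p =>
      ∀ σ ∈ setNames M P, ForcesStar M C P le φ (Function.update v (.set n) σ) p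
  | .allCls n φ, v => fun p =>
      ∀ S ∈ classNames M C P, ForcesStar M C P le φ (Function.update v (.cls n) S) p

end ClassForcing

-- A generic filter is only required to meet dense classes in `C`. The truth lemma (a statement
-- holds in the extension iff some condition in the filter star-forces it) therefore needs the
-- star-forcing relations to be classes. For atomic statements this is a recursion, and
-- impredicative comprehension solves it. Call a pair of classes an attempt if it solves the
-- recursion on a domain closed under the names it refers to. Attempts agree with star-forced
-- equality on their domains, so quantifying over all of them defines a largest one; by induction on
-- rank no pair of sets is missing, since it could be adjoined (`exists_class_starEq`). The same
-- device makes the set-names a class (`hasClass_setNames`), and the compound clauses are then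
-- definable (`Definable.forcesStar`).
--
-- Every star-forced statement is regular: closed downward, and containing any condition below which
-- it is dense (`isRegular_forcesStar`). So a condition that does not star-force `φ` has one below
-- it that star-forces `¬φ`. Hence the conditions deciding a statement are dense, as are those that
-- star-force all instances of a universal statement or refute one. Generic filters meet these
-- classes, which yields the truth lemma `decides_forcesStar`, by rank induction for equality and
-- then by induction on formulas.
--
-- If `p` star-forces `φ`, the truth lemma gives `φ` in every extension by a generic containing `p`.
-- Otherwise some `q ≤ p` star-forces `¬φ`; countability of `C` gives a generic containing `q`,
-- hence `p`, and `φ` fails in its extension.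

namespace ClassForcing

/-! ### Renaming variables in formulas -/

/-- The action on variables of a pair of index maps. -/
def Var.map (f g : ℕ → ℕ) : Var → Var
  | .set n => .set (f n)
  | .cls n => .cls (g n)

theorem Var.map_injective {f g : ℕ → ℕ} (hf : f.Injective) (hg : g.Injective) :
    (Var.map f g).Injective := by
  rintro (a | a) (b | b) h <;> simp only [Var.map, Var.set.injEq, Var.cls.injEq, reduceCtorEq] at h
  · rw [hf h]
  · rw [hg h]

/-- Rename all variables, free and bound. -/
def Formula.rename (f g : ℕ → ℕ) : Formula → Formula
  | .mem a b => .mem (a.map f g) (b.map f g)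
  | .eq a b => .eq (a.map f g) (b.map f g)
  | .and φ ψ => .and (φ.rename f g) (ψ.rename f g)
  | .neg φ => .neg (φ.rename f g)
  | .allSet n φ => .allSet (f n) (φ.rename f g)
  | .allCls n φ => .allCls (g n) (φ.rename f g)

/-- Injectivity prevents a renamed bound variable from capturing another one: updating at the image
and then composing equals composing and then updating. -/
theorem sat_rename {M C : Set ZFSet.{u}} {f g : ℕ → ℕ} (hf : f.Injective) (hg : g.Injective)
    (φ : Formula) (v : Var → ZFSet.{u}) :
    Sat M C (φ.rename f g) v ↔ Sat M C φ (v ∘ Var.map f g) := by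
  induction φ generalizing v with
  | mem a b => rfl
  | eq a b => rfl
  | and φ ψ h₁ h₂ => exact and_congr (h₁ v) (h₂ v)
  | neg φ h => exact not_congr (h v)
  | allSet n φ h =>
    simp only [Formula.rename, Sat, h]
    refine forall₂_congr fun x _ => ?_
    rw [show Var.set (f n) = Var.map f g (.set n) from rfl,
      Function.update_comp_eq_of_injective _ (Var.map_injective hf hg)]
  | allCls n φ h =>
    simp only [Formula.rename, Sat, h]
    refine forall₂_congr fun x _ => ?_
    rw [show Var.cls (g n) = Var.map f g (.cls n) from rfl,
      Function.update_comp_eq_of_injective _ (Var.map_injective hf hg)]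

/-! ### Definable predicates on environments

An environment is an assignment read as a pair of de Bruijn stacks. It occupies the set variables
with even index and the class variables with index divisible by 3 of an assignment `v`; the class
variables with index `3 * n + 1` hold the parameters `c n`, and the rest is spare room for bound
variables. -/

/-- The environment held by `v`. -/
def env (v : Var → ZFSet.{u}) : Var → ZFSet.{u} := v ∘ Var.map (2 * ·) (3 * ·)

/-- `v` holds the parameters `c`. -/
def HoldsParams (c : ℕ → ZFSet.{u}) (v : Var → ZFSet.{u}) : Prop :=
  ∀ n, v (.cls (3 * n + 1)) = c n

/-- Definability with parameters `c` over `(M, C)` of a predicate on environments. -/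
def Definable (M C : Set ZFSet.{u}) (c : ℕ → ZFSet.{u}) (R : (Var → ZFSet.{u}) → Prop) : Prop :=
  ∃ φ, ∀ v, IsAssignment M C v → HoldsParams c v → (R (env v) ↔ Sat M C φ v)

/-- `t` is a variable or a parameter. -/
def IsTerm (c : ℕ → ZFSet.{u}) (t : (Var → ZFSet.{u}) → ZFSet.{u}) : Prop :=
  (∃ a, ∀ e, t e = e a) ∨ ∃ n, ∀ e, t e = c n

/-- Drop the first set. -/
def tailSet (e : Var → ZFSet.{u}) : Var → ZFSet.{u} := e ∘ Var.map (· + 1) id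

/-- Drop the first class. -/
def tailCls (e : Var → ZFSet.{u}) : Var → ZFSet.{u} := e ∘ Var.map id (· + 1)

variable {M C : Set ZFSet.{u}} {c : ℕ → ZFSet.{u}} {s t w : (Var → ZFSet.{u}) → ZFSet.{u}}
  {R Q : (Var → ZFSet.{u}) → Prop}

theorem IsTerm.var (a : Var) (h : ∀ e, t e = e a) : IsTerm c t := .inl ⟨a, h⟩

theorem IsTerm.param {x : ZFSet.{u}} (hx : x ∈ Set.range c) : IsTerm c (fun _ => x) :=
  .inr (hx.imp fun _ h _ => h.symm)

theorem IsTerm.tailSet (h : IsTerm c t) : IsTerm c (fun e => t (tailSet e)) :=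
  h.imp (fun ⟨a, h⟩ => ⟨a.map (· + 1) id, fun e => h (e ∘ _)⟩) (fun ⟨n, h⟩ => ⟨n, fun _ => h _⟩)

theorem IsTerm.tailCls (h : IsTerm c t) : IsTerm c (fun e => t (tailCls e)) :=
  h.imp (fun ⟨a, h⟩ => ⟨a.map id (· + 1), fun e => h (e ∘ _)⟩) (fun ⟨n, h⟩ => ⟨n, fun _ => h _⟩)

theorem IsTerm.exists_var (h : IsTerm c t) : ∃ a, ∀ v, HoldsParams c v → t (env v) = v a := by
  obtain ⟨a, h⟩ | ⟨n, h⟩ := h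
  · exact ⟨_, fun v _ => h _⟩
  · exact ⟨.cls (3 * n + 1), fun v hv => (h _).trans (hv n).symm⟩

theorem IsAssignment.comp {e : Var → ZFSet.{u}} (he : IsAssignment M C e) (f g : ℕ → ℕ) :
    IsAssignment M C (e ∘ Var.map f g) := ⟨fun n => he.1 (f n), fun n => he.2 (g n)⟩

theorem IsAssignment.updateSet {e : Var → ZFSet.{u}} (he : IsAssignment M C e) {x : ZFSet.{u}}
    (hx : x ∈ M) (n : ℕ) : IsAssignment M C (Function.update e (.set n) x) := by
  refine ⟨fun m => ?_, fun m => by simpa using he.2 m⟩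
  by_cases h : m = n
  · simpa [h] using hx
  · simpa [Function.update_apply, h] using he.1 m

theorem IsAssignment.updateCls {e : Var → ZFSet.{u}} (he : IsAssignment M C e) {x : ZFSet.{u}}
    (hx : x ∈ C) (n : ℕ) : IsAssignment M C (Function.update e (.cls n) x) := by
  refine ⟨fun m => by simpa using he.1 m, fun m => ?_⟩
  by_cases h : m = n
  · simpa [h] using hx
  · simpa [Function.update_apply, h] using he.2 m

theorem IsTerm.mem_or_mem (h : IsTerm c t) (hc : ∀ n, c n ∈ C) {e : Var → ZFSet.{u}}
    (he : IsAssignment M C e) : t e ∈ M ∨ t e ∈ C := by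
  obtain ⟨a | a, h⟩ | ⟨n, h⟩ := h <;> rw [h]
  · exact .inl (he.1 a)
  · exact .inr (he.2 a)
  · exact .inr (hc n)

namespace Definable

/-- The equivalence is only needed at assignments into the model; this is what allows an unbounded
quantifier to be replaced by one bounded by `M`. -/
theorem congr (h : Definable M C c R)
    (H : ∀ e, IsAssignment M C e → (Q e ↔ R e)) : Definable M C c Q := by
  obtain ⟨φ, h⟩ := h
  exact ⟨φ, fun v hv hp => (H _ (hv.comp _ _)).trans (h v hv hp)⟩

theorem mem (hs : IsTerm c s) (ht : IsTerm c t) : Definable M C c (fun e => s e ∈ t e) := by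
  obtain ⟨a, ha⟩ := hs.exists_var
  obtain ⟨b, hb⟩ := ht.exists_var
  exact ⟨.mem a b, fun v _ hp => by simp only [ha v hp, hb v hp, Sat]⟩

theorem eq (hs : IsTerm c s) (ht : IsTerm c t) : Definable M C c (fun e => s e = t e) := by
  obtain ⟨a, ha⟩ := hs.exists_var
  obtain ⟨b, hb⟩ := ht.exists_var
  exact ⟨.eq a b, fun v _ hp => by simp only [ha v hp, hb v hp, Sat]⟩

theorem not (h : Definable M C c R) : Definable M C c (fun e => ¬ R e) := by
  obtain ⟨φ, h⟩ := h
  exact ⟨.neg φ, fun v hv hp => not_congr (h v hv hp)⟩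

theorem and (h : Definable M C c R) (h' : Definable M C c Q) :
    Definable M C c (fun e => R e ∧ Q e) := by
  obtain ⟨φ, h⟩ := h
  obtain ⟨ψ, h'⟩ := h'
  exact ⟨.and φ ψ, fun v hv hp => and_congr (h v hv hp) (h' v hv hp)⟩

theorem or (h : Definable M C c R) (h' : Definable M C c Q) :
    Definable M C c (fun e => R e ∨ Q e) :=
  (h.not.and h'.not).not.congr fun _ _ => by tauto

theorem imp (h : Definable M C c R) (h' : Definable M C c Q) :
    Definable M C c (fun e => R e → Q e) :=
  (h.and h'.not).not.congr fun _ _ => by tauto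

theorem iff (h : Definable M C c R) (h' : Definable M C c Q) :
    Definable M C c (fun e => R e ↔ Q e) :=
  ((h.imp h').and (h'.imp h)).congr fun _ _ => by tauto

/-- The index map that moves the head of the set stack to the spare variable `1`. -/
def popSet (k : ℕ) : ℕ := if k = 0 then 1 else if k % 2 = 0 then k - 2 else k + 2

/-- The index map that moves the head of the class stack to the spare variable `2`. -/
def popCls (k : ℕ) : ℕ :=
  if k = 0 then 2 else if k % 3 = 0 then k - 3 else if k % 3 = 1 then k else k + 3

theorem popSet_injective : popSet.Injective := by
  intro a b h; unfold popSet at h; split_ifs at h <;> omega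

theorem popCls_injective : popCls.Injective := by
  intro a b h; unfold popCls at h; split_ifs at h <;> omega

/-- The new variable stays exposed as set variable `1`, so one formula serves both under a
quantifier and in the comprehension axiom. Renaming by `popSet` makes stack position `0` read that
variable and the later positions read the old stack. -/
theorem exists_sat_update_set {Q : (Var → ZFSet.{u}) → ZFSet.{u} → Prop}
    (h : Definable M C c (fun e => Q (tailSet e) (e (.set 0)))) :
    ∃ φ, ∀ v, IsAssignment M C v → HoldsParams c v → ∀ x ∈ M,
      (Q (env v) x ↔ Sat M C φ (Function.update v (.set 1) x)) := by
  obtain ⟨φ, h⟩ := h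
  refine ⟨φ.rename popSet id, fun v hv hp x hx => ?_⟩
  rw [sat_rename popSet_injective Function.injective_id, ← h]
  · have h₀ : env (Function.update v (.set 1) x ∘ Var.map popSet id) (.set 0) = x := by
      simp [env, Var.map, popSet]
    have h₁ : tailSet (env (Function.update v (.set 1) x ∘ Var.map popSet id)) = env v := by
      funext a
      rcases a with n | n
      · have : popSet (2 * (n + 1)) = 2 * n := by
          rw [popSet, if_neg (by omega), if_pos (by omega)]; omega
        simp only [tailSet, env, Var.map, Function.comp, this]
        exact Function.update_of_ne (by simp only [ne_eq, Var.set.injEq]; omega) _ _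
      · simp [tailSet, env, Var.map]
    beta_reduce
    rw [h₀, h₁]
  · exact (hv.updateSet hx 1).comp _ _
  · intro n
    simpa [Var.map] using hp n

theorem allSet {Q : (Var → ZFSet.{u}) → ZFSet.{u} → Prop}
    (h : Definable M C c (fun e => Q (tailSet e) (e (.set 0)))) :
    Definable M C c (fun e => ∀ x ∈ M, Q e x) := by
  obtain ⟨φ, h⟩ := exists_sat_update_set h
  exact ⟨.allSet 1 φ, fun v hv hp => forall₂_congr fun x hx => h v hv hp x hx⟩

theorem allCls {Q : (Var → ZFSet.{u}) → ZFSet.{u} → Prop}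
    (h : Definable M C c (fun e => Q (tailCls e) (e (.cls 0)))) :
    Definable M C c (fun e => ∀ X ∈ C, Q e X) := by
  obtain ⟨φ, h⟩ := h
  refine ⟨.allCls 2 (φ.rename id popCls), fun v hv hp => forall₂_congr fun x hx => ?_⟩
  rw [sat_rename Function.injective_id popCls_injective, ← h]
  · have h₀ : env (Function.update v (.cls 2) x ∘ Var.map id popCls) (.cls 0) = x := by
      simp [env, Var.map, popCls]
    have h₁ : tailCls (env (Function.update v (.cls 2) x ∘ Var.map id popCls)) = env v := by
      funext a
      rcases a with n | n
      · simp [tailCls, env, Var.map]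
      · have : popCls (3 * (n + 1)) = 3 * n := by
          rw [popCls, if_neg (by omega), if_pos (by omega)]; omega
        simp only [tailCls, env, Var.map, Function.comp, this]
        exact Function.update_of_ne (by simp only [ne_eq, Var.cls.injEq]; omega) _ _
    beta_reduce
    rw [h₀, h₁]
  · exact (hv.updateCls hx 2).comp _ _
  · intro n
    -- Class variables of index `1` modulo `3` are fixed, so the parameters survive the pop.
    have : popCls (3 * n + 1) = 3 * n + 1 := by
      rw [popCls, if_neg (by omega), if_neg (by omega), if_pos (by omega)]
    simp only [Var.map, Function.comp, this]
    rw [Function.update_of_ne (by simp only [ne_eq, Var.cls.injEq]; omega)]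
    exact hp n

theorem exSet {Q : (Var → ZFSet.{u}) → ZFSet.{u} → Prop}
    (h : Definable M C c (fun e => Q (tailSet e) (e (.set 0)))) :
    Definable M C c (fun e => ∃ x ∈ M, Q e x) :=
  (allSet (Q := fun e x => ¬ Q e x) h.not).not.congr fun _ _ => by push Not; rfl

theorem exCls {Q : (Var → ZFSet.{u}) → ZFSet.{u} → Prop}
    (h : Definable M C c (fun e => Q (tailCls e) (e (.cls 0)))) :
    Definable M C c (fun e => ∃ X ∈ C, Q e X) :=
  (allCls (Q := fun e x => ¬ Q e x) h.not).not.congr fun _ _ => by push Not; rfl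

/-- Insert an unused set below the head of the stack. -/
theorem skip {Q : (Var → ZFSet.{u}) → ZFSet.{u} → Prop}
    (h : Definable M C c (fun e => Q (tailSet e) (e (.set 0)))) :
    Definable M C c (fun e => Q (tailSet (tailSet e)) (e (.set 0))) := by
  obtain ⟨φ, h⟩ := h
  have hf : (fun k => if k = 0 then 0 else k + 2 : ℕ → ℕ).Injective := by
    intro a b h; simp only at h; split_ifs at h <;> omega
  refine ⟨φ.rename (fun k => if k = 0 then 0 else k + 2) id, fun v hv hp => ?_⟩
  rw [sat_rename hf Function.injective_id, ← h _ (hv.comp _ _) (by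
    intro n; simpa [Var.map] using hp n)]
  have h₁ : tailSet (env (v ∘ Var.map (fun k => if k = 0 then 0 else k + 2) id)) =
      tailSet (tailSet (env v)) := by
    funext a
    rcases a with n | n <;> simp [tailSet, env, Var.map, mul_add]
  beta_reduce
  rw [h₁]
  simp [env, Var.map]

theorem comprehension (hMK : IsMKModel M C) (hc : ∀ n, c n ∈ C)
    {Q : (Var → ZFSet.{u}) → ZFSet.{u} → Prop}
    (h : Definable M C c (fun e => Q (tailSet e) (e (.set 0)))) {e : Var → ZFSet.{u}}
    (he : IsAssignment M C e) : ∃ Y ∈ C, ∀ x ∈ M, x ∈ Y ↔ Q e x := by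
  obtain ⟨φ, h⟩ := exists_sat_update_set h
  -- Interleave the given environment with the parameters; the spare variables receive arbitrary
  -- values of the right sort.
  let v : Var → ZFSet.{u}
    | .set n => e (.set (n / 2))
    | .cls n => if n % 3 = 1 then c (n / 3) else e (.cls (n / 3))
  have hv : IsAssignment M C v :=
    ⟨fun n => he.1 _, fun n => by simp only [v]; split_ifs; exacts [hc _, he.2 _]⟩
  have hp : HoldsParams c v := fun n => by
    have h₁ : (3 * n + 1) % 3 = 1 := by omega
    have h₂ : (3 * n + 1) / 3 = n := by omega
    simp only [v, h₁, h₂, if_true]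
  have hev : env v = e := by
    funext a
    rcases a with n | n <;> simp [env, Var.map, v]
  obtain ⟨Y, hY, H⟩ := hMK.comprehension φ 1 v hv
  exact ⟨Y, hY, fun x hx => (H x hx).trans (by rw [← h v hv hp x hx, hev])⟩

end Definable

end ClassForcing

namespace ClassForcing

/-! ### Closure properties of models -/

section Model

variable {M C : Set ZFSet.{u}}

theorem IsMKModel.mem_of_mem (h : IsMKModel M C) {x y : ZFSet.{u}} (hx : x ∈ M ∨ x ∈ C)
    (hy : y ∈ x) : y ∈ M :=
  hx.elim (fun hx => h.transitive x hx y hy) (fun hx => h.subset x hx y hy)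

theorem IsMKModel.insert_singleton_mem (h : IsMKModel M C) {x y : ZFSet.{u}} (hx : x ∈ M)
    (hy : y ∈ M) : ({x, y} : ZFSet.{u}) ∈ M := by
  obtain ⟨z, hz, H⟩ := h.pairing x hx y hy
  convert hz
  ext w
  rw [ZFSet.mem_pair]
  refine ⟨fun hw => (H w ?_).2 hw, fun hw => (H w (h.transitive z hz w hw)).1 hw⟩
  rcases hw with rfl | rfl <;> assumption

theorem IsMKModel.singleton_mem (h : IsMKModel M C) {x : ZFSet.{u}} (hx : x ∈ M) :
    ({x} : ZFSet.{u}) ∈ M := by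
  rw [← ZFSet.pair_eq_singleton]
  exact h.insert_singleton_mem hx hx

theorem IsMKModel.pair_mem (h : IsMKModel M C) {x y : ZFSet.{u}} (hx : x ∈ M) (hy : y ∈ M) :
    ZFSet.pair x y ∈ M :=
  h.insert_singleton_mem (h.singleton_mem hx) (h.insert_singleton_mem hx hy)

theorem IsMKModel.of_pair_mem (h : IsMKModel M C) {x y : ZFSet.{u}} (hp : ZFSet.pair x y ∈ M) :
    x ∈ M ∧ y ∈ M := by
  have h₁ : ({x, y} : ZFSet.{u}) ∈ M := h.transitive _ hp _ (by simp [ZFSet.pair])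
  exact ⟨h.transitive _ h₁ _ (by simp), h.transitive _ h₁ _ (by simp)⟩

theorem IsMKModel.of_pair_mem_of_mem (h : IsMKModel M C) {x y z : ZFSet.{u}} (hz : z ∈ M ∨ z ∈ C)
    (hp : ZFSet.pair x y ∈ z) : x ∈ M ∧ y ∈ M :=
  h.of_pair_mem (h.mem_of_mem hz hp)

theorem IsMKModel.exists_mem (h : IsMKModel M C) : ∃ x, x ∈ M := by
  obtain ⟨x, hx, -⟩ := h.infinity
  exact ⟨x, hx⟩

theorem IsMKModel.exists_mem_cls (h : IsMKModel M C) : ∃ x, x ∈ C := by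
  obtain ⟨x, hx, -⟩ := h.global_choice
  exact ⟨x, hx⟩

/-- Parameters live in class variables, so this is what lets sets serve as parameters too. -/
theorem IsMKModel.mem_cls_of_mem (h : IsMKModel M C) {x : ZFSet.{u}} (hx : x ∈ M) : x ∈ C := by
  obtain ⟨X, hX⟩ := h.exists_mem_cls
  obtain ⟨Y, hY, H⟩ := h.comprehension (.mem (.set 0) (.set 1)) 0
    (fun a => match a with | .set _ => x | .cls _ => X) ⟨fun _ => hx, fun _ => hX⟩
  convert hY
  ext z
  simp only [Sat, Function.update_self, ne_eq, Var.set.injEq, one_ne_zero, not_false_eq_true,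
    Function.update_of_ne] at H
  exact ⟨fun hz => (H z (h.transitive x hx z hz)).2 hz, fun hz => (H z (h.subset Y hY z hz)).1 hz⟩

end Model

/-! ### Definability of elementary notions -/

section Definability

variable {M C : Set ZFSet.{u}} {c : ℕ → ZFSet.{u}} {s t w : (Var → ZFSet.{u}) → ZFSet.{u}}
  {le : ZFSet.{u}}

namespace Definable

theorem eq_upair (hMK : IsMKModel M C) (hc : ∀ n, c n ∈ C)
    (hs : IsTerm c s) (ht : IsTerm c t) (hw : IsTerm c w) :
    Definable M C c (fun e => s e = {t e, w e}) := by
  have h : Definable M C c (fun e => t e ∈ s e ∧ w e ∈ s e ∧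
      ∀ x ∈ M, x ∈ s e → x = t e ∨ x = w e) := by
    refine (mem ht hs).and ((mem hw hs).and (allSet ?_))
    have h₀ : IsTerm c (fun e => e (.set 0)) := .var (.set 0) fun _ => rfl
    exact (mem h₀ hs.tailSet).imp ((eq h₀ ht.tailSet).or (eq h₀ hw.tailSet))
  refine h.congr fun e he => ⟨fun h => ?_, fun ⟨h₁, h₂, h₃⟩ => ?_⟩
  · simp only [h, ZFSet.mem_pair, true_or, or_true, true_and]
    exact fun _ _ => id
  · ext x
    rw [ZFSet.mem_pair]
    refine ⟨fun hx => h₃ x (hMK.mem_of_mem (hs.mem_or_mem hc he) hx) hx, ?_⟩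
    rintro (rfl | rfl) <;> assumption

/-- The Kuratowski pair, spelled out with its two members as witnesses; they lie in `M` because the
members of any set or class of the model do. -/
theorem eq_pair (hMK : IsMKModel M C) (hc : ∀ n, c n ∈ C)
    (hs : IsTerm c s) (ht : IsTerm c t) (hw : IsTerm c w) :
    Definable M C c (fun e => s e = ZFSet.pair (t e) (w e)) := by
  have h : Definable M C c (fun e => (∃ x ∈ M, x = {t e, t e} ∧ ∃ y ∈ M, y = {t e, w e} ∧
      s e = {x, y})) := by
    refine exSet (.and (eq_upair hMK hc ?_ ht.tailSet ht.tailSet)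
      (exSet (.and (eq_upair hMK hc ?_ ht.tailSet.tailSet hw.tailSet.tailSet)
      (eq_upair hMK hc hs.tailSet.tailSet ?_ ?_))))
    exacts [.var (.set 0) fun _ => rfl, .var (.set 0) fun _ => rfl, .var (.set 1) fun _ => rfl,
      .var (.set 0) fun _ => rfl]
  refine h.congr fun e he => ⟨fun h => ?_, ?_⟩
  · have := fun x => hMK.mem_of_mem (y := x) (hs.mem_or_mem hc he)
    rw [h] at this
    refine ⟨_, this {t e, t e} ?_, rfl, _, this {t e, w e} ?_, rfl, ?_⟩
    · simp [ZFSet.pair]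
    · simp [ZFSet.pair]
    · rw [h, ZFSet.pair_eq_singleton]; rfl
  · rintro ⟨_, _, rfl, _, _, rfl, h⟩
    rw [h, ZFSet.pair_eq_singleton]; rfl

theorem pair_mem (hMK : IsMKModel M C) (hc : ∀ n, c n ∈ C)
    (ht : IsTerm c t) (hw : IsTerm c w) (hs : IsTerm c s) :
    Definable M C c (fun e => ZFSet.pair (t e) (w e) ∈ s e) := by
  have h : Definable M C c (fun e => ∃ x ∈ M, x ∈ s e ∧ x = ZFSet.pair (t e) (w e)) := by
    refine exSet (.and (mem ?_ hs.tailSet) (eq_pair hMK hc ?_ ht.tailSet hw.tailSet))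
    exacts [.var (.set 0) fun _ => rfl, .var (.set 0) fun _ => rfl]
  refine h.congr fun e he => ⟨fun h => ⟨_, hMK.mem_of_mem (hs.mem_or_mem hc he) h, h, rfl⟩, ?_⟩
  rintro ⟨_, _, h, rfl⟩
  exact h

theorem pair_pair_mem (hMK : IsMKModel M C) (hc : ∀ n, c n ∈ C) {a : (Var → ZFSet.{u}) → ZFSet.{u}}
    (ha : IsTerm c a) (ht : IsTerm c t) (hw : IsTerm c w) (hs : IsTerm c s) :
    Definable M C c (fun e => ZFSet.pair (ZFSet.pair (a e) (t e)) (w e) ∈ s e) := by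
  have h : Definable M C c (fun e => ∃ x ∈ M, x = ZFSet.pair (a e) (t e) ∧
      ZFSet.pair x (w e) ∈ s e) := by
    refine exSet (.and (eq_pair hMK hc ?_ ha.tailSet ht.tailSet)
      (pair_mem hMK hc ?_ hw.tailSet hs.tailSet))
    exacts [.var (.set 0) fun _ => rfl, .var (.set 0) fun _ => rfl]
  refine h.congr fun e he => ⟨fun h => ⟨_, ?_, rfl, h⟩, ?_⟩
  · exact (hMK.of_pair_mem_of_mem (hs.mem_or_mem hc he) h).1
  · rintro ⟨_, _, rfl, h⟩
    exact h

/-- Bounding both coordinates by `M` loses nothing, by transitivity. On the stack, `π` is at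
position `1` and `r` at position `0`. -/
theorem exists_pair_mem (hMK : IsMKModel M C) (hc : ∀ n, c n ∈ C) (ht : IsTerm c t)
    {Q : (Var → ZFSet.{u}) → ZFSet.{u} → ZFSet.{u} → Prop}
    (h : Definable M C c (fun e => Q (tailSet (tailSet e)) (e (.set 1)) (e (.set 0)))) :
    Definable M C c (fun e => ∃ π r, ZFSet.pair π r ∈ t e ∧ Q e π r) := by
  have h : Definable M C c (fun e => ∃ π ∈ M, ∃ r ∈ M, ZFSet.pair π r ∈ t e ∧ Q e π r) :=
    exSet (exSet (.and (pair_mem hMK hc (.var (.set 1) fun _ => rfl) (.var (.set 0) fun _ => rfl)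
      ht.tailSet.tailSet) h))
  refine h.congr fun e he => ⟨?_, ?_⟩
  · rintro ⟨π, r, h, hQ⟩
    obtain ⟨hπ, hr⟩ := hMK.of_pair_mem_of_mem (ht.mem_or_mem hc he) h
    exact ⟨π, hπ, r, hr, h, hQ⟩
  · rintro ⟨π, -, r, -, h, hQ⟩
    exact ⟨π, r, h, hQ⟩

theorem forall_pair_mem (hMK : IsMKModel M C) (hc : ∀ n, c n ∈ C) (ht : IsTerm c t)
    {Q : (Var → ZFSet.{u}) → ZFSet.{u} → ZFSet.{u} → Prop}
    (h : Definable M C c (fun e => Q (tailSet (tailSet e)) (e (.set 1)) (e (.set 0)))) :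
    Definable M C c (fun e => ∀ π r, ZFSet.pair π r ∈ t e → Q e π r) :=
  (exists_pair_mem hMK hc ht (Q := fun e π r => ¬ Q e π r) h.not).not.congr
    fun _ _ => by push Not; rfl

theorem exists_le (hMK : IsMKModel M C) (hc : ∀ n, c n ∈ C) (hle : le ∈ Set.range c)
    (ht : IsTerm c t) {A : (Var → ZFSet.{u}) → ZFSet.{u} → Prop}
    (h : Definable M C c (fun e => A (tailSet e) (e (.set 0)))) :
    Definable M C c (fun e => ∃ r, ZFSet.pair r (t e) ∈ le ∧ A e r) := by
  have h : Definable M C c (fun e => ∃ r ∈ M, ZFSet.pair r (t e) ∈ le ∧ A e r) :=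
    exSet (.and (pair_mem hMK hc (.var (.set 0) fun _ => rfl) ht.tailSet (.param hle)) h)
  refine h.congr fun e he => ⟨?_, fun ⟨r, _, hr⟩ => ⟨r, hr⟩⟩
  rintro ⟨r, h, hA⟩
  obtain ⟨n, rfl⟩ := hle
  exact ⟨r, (hMK.of_pair_mem_of_mem (.inr (hc n)) h).1, h, hA⟩

theorem forall_le (hMK : IsMKModel M C) (hc : ∀ n, c n ∈ C) (hle : le ∈ Set.range c)
    (ht : IsTerm c t) {A : (Var → ZFSet.{u}) → ZFSet.{u} → Prop}
    (h : Definable M C c (fun e => A (tailSet e) (e (.set 0)))) :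
    Definable M C c (fun e => ∀ r, ZFSet.pair r (t e) ∈ le → A e r) :=
  (exists_le hMK hc hle ht (A := fun e r => ¬ A e r) h.not).not.congr
    fun _ _ => by push Not; rfl

theorem starNeg (hMK : IsMKModel M C) (hc : ∀ n, c n ∈ C) (hle : le ∈ Set.range c)
    (ht : IsTerm c t) {A : (Var → ZFSet.{u}) → ZFSet.{u} → Prop}
    (h : Definable M C c (fun e => A (tailSet e) (e (.set 0)))) :
    Definable M C c (fun e => starNeg le (A e) (t e)) :=
  forall_le hMK hc hle ht (A := fun e r => ¬ A e r) h.not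

theorem denseBelow (hMK : IsMKModel M C) (hc : ∀ n, c n ∈ C) (hle : le ∈ Set.range c)
    (ht : IsTerm c t) {A : (Var → ZFSet.{u}) → ZFSet.{u} → Prop}
    (h : Definable M C c (fun e => A (tailSet e) (e (.set 0)))) :
    Definable M C c (fun e => DenseBelow le (A e) (t e)) :=
  forall_le hMK hc hle ht (exists_le hMK hc hle (.var (.set 0) fun _ => rfl)
    (A := fun e => A (tailSet e)) h.skip)

theorem starIff (hMK : IsMKModel M C) (hc : ∀ n, c n ∈ C) (hle : le ∈ Set.range c)
    (ht : IsTerm c t) {A B : (Var → ZFSet.{u}) → ZFSet.{u} → Prop}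
    (hA : Definable M C c (fun e => A (tailSet e) (e (.set 0))))
    (hB : Definable M C c (fun e => B (tailSet e) (e (.set 0)))) :
    Definable M C c (fun e => starIff le (A e) (B e) (t e)) := by
  have h₀ : IsTerm c (fun e => e (.set 0)) := .var (.set 0) fun _ => rfl
  exact .and
    (starNeg hMK hc hle ht (A := fun e => starAnd (A e) (ClassForcing.starNeg le (B e)))
      (hA.and (starNeg hMK hc hle h₀ (A := fun e => B (tailSet e)) hB.skip)))
    (starNeg hMK hc hle ht (A := fun e => starAnd (B e) (ClassForcing.starNeg le (A e)))
      (hB.and (starNeg hMK hc hle h₀ (A := fun e => A (tailSet e)) hA.skip)))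

end Definable

end Definability

end ClassForcing

-- Star-forcing of atomic statements is definable.

namespace ClassForcing

/-- `A` is the trace on `M` of a class. -/
def HasClass (M C : Set ZFSet.{u}) (A : ZFSet.{u} → Prop) : Prop :=
  ∃ Y ∈ C, ∀ x ∈ M, x ∈ Y ↔ A x

section Atomic

variable {M C : Set ZFSet.{u}} {c : ℕ → ZFSet.{u}} {s t w : (Var → ZFSet.{u}) → ZFSet.{u}}
  {le : ZFSet.{u}}

theorem Definable.hasClass (hMK : IsMKModel M C) (hc : ∀ n, c n ∈ C) {A : ZFSet.{u} → Prop}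
    (h : Definable M C c (fun e => A (e (.set 0)))) : HasClass M C A := by
  obtain ⟨x, hx⟩ := hMK.exists_mem
  obtain ⟨X, hX⟩ := hMK.exists_mem_cls
  exact Definable.comprehension hMK hc (Q := fun _ x => A x) h
    (e := fun a => match a with | .set _ => x | .cls _ => X) ⟨fun _ => hx, fun _ => hX⟩

/-- The clause for `∈`, with `R π` in place of star-forcing equality of `π` and the left side. -/
def memClause (le : ZFSet.{u}) (R : ZFSet.{u} → ZFSet.{u} → Prop) (γ p : ZFSet.{u}) : Prop :=
  DenseBelow le (fun q => ∃ π r, ZFSet.pair π r ∈ γ ∧ ZFSet.pair q r ∈ le ∧ R π q) p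

/-- The clause for `=`, with `R` in place of the instances of star-forced equality it depends on. -/
def eqClause (le : ZFSet.{u}) (R : ZFSet.{u} → ZFSet.{u} → ZFSet.{u} → Prop)
    (σ γ p : ZFSet.{u}) : Prop :=
  ∀ π r, ZFSet.pair π r ∈ σ ∪ γ →
    starIff le (memClause le (fun π' => R π' π) σ) (memClause le (fun π' => R π' π) γ) p

theorem starMem_eq (le σ γ : ZFSet.{u}) :
    StarMem le σ γ = memClause le (fun π => StarEq le π σ) γ := by
  funext p
  rw [StarMem, memClause]
  simp only [exists_prop]

/-- Substituting the membership clause turns the mutual recursion into a recursion for equality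
alone, on pairs of names of smaller maximal rank. -/
theorem starEq_eq (le σ γ : ZFSet.{u}) : StarEq le σ γ = eqClause le (StarEq le) σ γ := by
  funext p
  rw [StarEq, eqClause]
  simp only [starMem_eq]

theorem DenseBelow.congr {le p : ZFSet.{u}} {A B : ZFSet.{u} → Prop}
    (h : ∀ q r, ZFSet.pair q r ∈ le → (A q ↔ B q)) : DenseBelow le A p ↔ DenseBelow le B p :=
  forall₂_congr fun q _ => exists_congr fun r => and_congr_right fun hr => h r q hr

theorem memClause_congr {le γ : ZFSet.{u}} {R R' : ZFSet.{u} → ZFSet.{u} → Prop}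
    (h : ∀ π r, ZFSet.pair π r ∈ γ → ∀ q s, ZFSet.pair q s ∈ le → (R π q ↔ R' π q)) :
    memClause le R γ = memClause le R' γ := by
  funext p
  refine propext (DenseBelow.congr fun q s hq => exists₂_congr fun π r => ?_)
  exact and_congr_right fun hπ => and_congr_right fun _ => h π r hπ q s hq

/-- Locality of the recursion: only pairs of names occurring in `σ ∪ γ`, at genuine conditions, are
consulted. Even when `σ` and `γ` are classes, those names are sets. -/
theorem eqClause_congr {le σ γ : ZFSet.{u}} {R R' : ZFSet.{u} → ZFSet.{u} → ZFSet.{u} → Prop}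
    (h : ∀ π r, ZFSet.pair π r ∈ σ ∪ γ → ∀ π' r', ZFSet.pair π' r' ∈ σ ∪ γ →
      ∀ q s, ZFSet.pair q s ∈ le → (R π' π q ↔ R' π' π q)) :
    eqClause le R σ γ = eqClause le R' σ γ := by
  funext p
  refine propext (forall₂_congr fun π r => forall_congr' fun hπ => ?_)
  rw [memClause_congr (R := fun π' => R π' π) (R' := fun π' => R' π' π)
      fun π' r' h' => h π r hπ π' r' (ZFSet.mem_union.2 (.inl h')),
    memClause_congr (R := fun π' => R π' π) (R' := fun π' => R' π' π)
      fun π' r' h' => h π r hπ π' r' (ZFSet.mem_union.2 (.inr h'))]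

theorem max_rank_lt_of_pair_mem_union {σ γ π r π' r' : ZFSet.{u}}
    (h : ZFSet.pair π r ∈ σ ∪ γ) (h' : ZFSet.pair π' r' ∈ σ ∪ γ) :
    max π'.rank π.rank < max σ.rank γ.rank := by
  rw [← ZFSet.rank_union σ γ]
  exact max_lt (rank_lt_of_pair_mem h') (rank_lt_of_pair_mem h)

namespace Definable

theorem forall_pair_mem_union (hMK : IsMKModel M C) (hc : ∀ n, c n ∈ C)
    (hs : IsTerm c s) (ht : IsTerm c t)
    {Q : (Var → ZFSet.{u}) → ZFSet.{u} → ZFSet.{u} → Prop}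
    (h : Definable M C c (fun e => Q (tailSet (tailSet e)) (e (.set 1)) (e (.set 0)))) :
    Definable M C c (fun e => ∀ π r, ZFSet.pair π r ∈ s e ∪ t e → Q e π r) :=
  ((forall_pair_mem hMK hc hs h).and (forall_pair_mem hMK hc ht h)).congr fun e _ => by
    simp only [ZFSet.mem_union, or_imp, forall_and]

theorem memClause (hMK : IsMKModel M C) (hc : ∀ n, c n ∈ C) (hle : le ∈ Set.range c)
    {R : (Var → ZFSet.{u}) → ZFSet.{u} → ZFSet.{u} → Prop}
    (hR : Definable M C c
      (fun e => R (tailSet (tailSet (tailSet e))) (e (.set 1)) (e (.set 2))))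
    (ht : IsTerm c t) (hw : IsTerm c w) :
    Definable M C c (fun e => memClause le (R e) (t e) (w e)) := by
  refine denseBelow hMK hc hle hw (exists_pair_mem hMK hc ht.tailSet (.and ?_ ?_))
  · exact pair_mem hMK hc (.var (.set 2) fun _ => rfl) (.var (.set 0) fun _ => rfl) (.param hle)
  · exact hR

theorem eqClause (hMK : IsMKModel M C) (hc : ∀ n, c n ∈ C) (hle : le ∈ Set.range c)
    {E : (Var → ZFSet.{u}) → ZFSet.{u}} (hE : IsTerm c E)
    (hs : IsTerm c s) (ht : IsTerm c t) (hw : IsTerm c w) :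
    Definable M C c (fun e => eqClause le
      (fun π' π q => ZFSet.pair (ZFSet.pair π' π) q ∈ E e) (s e) (t e) (w e)) := by
  refine forall_pair_mem_union hMK hc hs ht (starIff hMK hc hle hw.tailSet.tailSet
    (memClause hMK hc hle ?_ hs.tailSet.tailSet.tailSet (.var (.set 0) fun _ => rfl))
    (memClause hMK hc hle ?_ ht.tailSet.tailSet.tailSet (.var (.set 0) fun _ => rfl)))
  all_goals
    exact pair_pair_mem hMK hc (.var (.set 1) fun _ => rfl) (.var (.set 5) fun _ => rfl)
      (.var (.set 2) fun _ => rfl) hE.tailSet.tailSet.tailSet.tailSet.tailSet.tailSet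

end Definable

/-- `E` is a solution of the recursion for star-forced equality on the collection `W` of pairs. -/
def EqAttempt (M : Set ZFSet.{u}) (le W E : ZFSet.{u}) : Prop :=
  ∀ σ ∈ M, ∀ γ ∈ M, ZFSet.pair σ γ ∈ W →
    (∀ π r, ZFSet.pair π r ∈ σ ∪ γ → ∀ π' r', ZFSet.pair π' r' ∈ σ ∪ γ → ZFSet.pair π' π ∈ W) ∧
    ∀ q ∈ M, ZFSet.pair (ZFSet.pair σ γ) q ∈ E ↔
      eqClause le (fun π' π q => ZFSet.pair (ZFSet.pair π' π) q ∈ E) σ γ q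

theorem Definable.eqAttempt (hMK : IsMKModel M C) (hc : ∀ n, c n ∈ C) (hle : le ∈ Set.range c)
    {E : (Var → ZFSet.{u}) → ZFSet.{u}} (hw : IsTerm c w) (hE : IsTerm c E) :
    Definable M C c (fun e => EqAttempt M le (w e) (E e)) := by
  refine allSet (allSet (.imp (pair_mem hMK hc (.var (.set 1) fun _ => rfl)
    (.var (.set 0) fun _ => rfl) hw.tailSet.tailSet) (.and ?_ (allSet (.iff ?_ ?_)))))
  · refine forall_pair_mem_union hMK hc (.var (.set 1) fun _ => rfl) (.var (.set 0) fun _ => rfl)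
      (forall_pair_mem_union hMK hc (.var (.set 3) fun _ => rfl) (.var (.set 2) fun _ => rfl)
        (pair_mem hMK hc (.var (.set 1) fun _ => rfl) (.var (.set 3) fun _ => rfl)
          hw.tailSet.tailSet.tailSet.tailSet.tailSet.tailSet))
  · exact pair_pair_mem hMK hc (.var (.set 2) fun _ => rfl) (.var (.set 1) fun _ => rfl)
      (.var (.set 0) fun _ => rfl) hE.tailSet.tailSet.tailSet
  · exact eqClause hMK hc hle hE.tailSet.tailSet.tailSet (.var (.set 2) fun _ => rfl)
      (.var (.set 1) fun _ => rfl) (.var (.set 0) fun _ => rfl)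

/-- Uniqueness of the recursion, by induction on the maximal rank; closure of `W` keeps the smaller
pairs inside the domain. -/
theorem EqAttempt.iff_starEq (hMK : IsMKModel M C) (hle : le ∈ C) {W E : ZFSet.{u}}
    (h : EqAttempt M le W E) {σ γ q : ZFSet.{u}} (hσ : σ ∈ M) (hγ : γ ∈ M)
    (hW : ZFSet.pair σ γ ∈ W) (hq : q ∈ M) :
    ZFSet.pair (ZFSet.pair σ γ) q ∈ E ↔ StarEq le σ γ q := by
  induction hn : max σ.rank γ.rank using WellFoundedLT.induction generalizing σ γ q with
  | _ n ih =>
    obtain ⟨h₁, h₂⟩ := h σ hσ γ hγ hW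
    rw [h₂ q hq, starEq_eq, eqClause_congr]
    intro π r hπ π' r' hπ' q s hqs
    have hM : ∀ {π r}, ZFSet.pair π r ∈ σ ∪ γ → π ∈ M := fun {π r} h =>
      (ZFSet.mem_union.1 h).elim (fun h => (hMK.of_pair_mem_of_mem (.inl hσ) h).1)
        (fun h => (hMK.of_pair_mem_of_mem (.inl hγ) h).1)
    exact ih _ (hn ▸ max_rank_lt_of_pair_mem_union hπ hπ') (hM hπ') (hM hπ) (h₁ π r hπ π' r' hπ')
      (hMK.of_pair_mem_of_mem (.inr hle) hqs).1 rfl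

theorem EqAttempt.of_iff_starEq (hMK : IsMKModel M C) (hle : le ∈ C) {W E : ZFSet.{u}}
    (h : ∀ σ ∈ M, ∀ γ ∈ M, ZFSet.pair σ γ ∈ W → ∀ π r, ZFSet.pair π r ∈ σ ∪ γ →
      ∀ π' r', ZFSet.pair π' r' ∈ σ ∪ γ → ZFSet.pair π' π ∈ W)
    (h' : ∀ σ ∈ M, ∀ γ ∈ M, ZFSet.pair σ γ ∈ W → ∀ q ∈ M,
      (ZFSet.pair (ZFSet.pair σ γ) q ∈ E ↔ StarEq le σ γ q)) : EqAttempt M le W E := by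
  refine fun σ hσ γ hγ hW => ⟨h σ hσ γ hγ hW, fun q hq => ?_⟩
  rw [h' σ hσ γ hγ hW q hq, starEq_eq, eqClause_congr]
  intro π r hπ π' r' hπ' q s hqs
  have hM : ∀ {π r}, ZFSet.pair π r ∈ σ ∪ γ → π ∈ M := fun {π r} h =>
    (ZFSet.mem_union.1 h).elim (fun h => (hMK.of_pair_mem_of_mem (.inl hσ) h).1)
      (fun h => (hMK.of_pair_mem_of_mem (.inl hγ) h).1)
  exact (h' _ (hM hπ') _ (hM hπ) (h σ hσ γ hγ hW π r hπ π' r' hπ') q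
    (hMK.of_pair_mem_of_mem (.inr hle) hqs).1).symm

/-- Star-forced equality of sets is a class. -/
theorem exists_class_starEq (hMK : IsMKModel M C) (hc : Set.range c = C) (hle : le ∈ C) :
    ∃ E ∈ C, ∀ σ ∈ M, ∀ γ ∈ M, ∀ q ∈ M,
      ZFSet.pair (ZFSet.pair σ γ) q ∈ E ↔ StarEq le σ γ q := by
  have hc' : ∀ n, c n ∈ C := fun n => hc ▸ ⟨n, rfl⟩
  have hr : ∀ {x}, x ∈ C → x ∈ Set.range c := fun h => hc.symm ▸ h
  have h₀ : IsTerm c (fun e => e (.set 0)) := .var (.set 0) fun _ => rfl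
  -- The union of the domains of all attempts; the class quantifiers make this an impredicative use
  -- of comprehension.
  obtain ⟨W, hWC, hW⟩ := Definable.hasClass hMK hc'
    (A := fun x => ∃ W ∈ C, ∃ E ∈ C, EqAttempt M le W E ∧ x ∈ W)
    (.exCls (.exCls (.and (.eqAttempt hMK hc' (hr hle) (.var (.cls 1) fun _ => rfl)
      (.var (.cls 0) fun _ => rfl)) (.mem h₀ (.var (.cls 1) fun _ => rfl)))))
  -- An attempt is unconstrained off its domain, so only its triples over that domain are collected.
  obtain ⟨E, hEC, hE⟩ := Definable.hasClass hMK hc'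
    (A := fun x => ∃ W ∈ C, ∃ E ∈ C, EqAttempt M le W E ∧ x ∈ E ∧
      ∃ z ∈ M, z ∈ W ∧ ∃ q ∈ M, x = ZFSet.pair z q)
    (.exCls (.exCls (.and (.eqAttempt hMK hc' (hr hle) (.var (.cls 1) fun _ => rfl)
      (.var (.cls 0) fun _ => rfl)) (.and (.mem h₀ (.var (.cls 0) fun _ => rfl))
      (.exSet (.and (.mem h₀ (.var (.cls 1) fun _ => rfl)) (.exSet
      (.eq_pair hMK hc' (.var (.set 2) fun _ => rfl) (.var (.set 1) fun _ => rfl) h₀))))))))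
  have hcl : ∀ σ ∈ M, ∀ γ ∈ M, ZFSet.pair σ γ ∈ W → ∀ π r, ZFSet.pair π r ∈ σ ∪ γ →
      ∀ π' r', ZFSet.pair π' r' ∈ σ ∪ γ → ZFSet.pair π' π ∈ W := by
    intro σ hσ γ hγ h π r hπ π' r' hπ'
    obtain ⟨W', hW', E', hE', h₁, h₂⟩ := (hW _ (hMK.subset W hWC _ h)).1 h
    have := (h₁ σ hσ γ hγ h₂).1 π r hπ π' r' hπ'
    exact (hW _ (hMK.subset W' hW' _ this)).2 ⟨W', hW', E', hE', h₁, this⟩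
  have hco : ∀ σ ∈ M, ∀ γ ∈ M, ZFSet.pair σ γ ∈ W → ∀ q ∈ M,
      (ZFSet.pair (ZFSet.pair σ γ) q ∈ E ↔ StarEq le σ γ q) := by
    intro σ hσ γ hγ h q hq
    have hM := hMK.pair_mem (hMK.subset W hWC _ h) hq
    rw [hE _ hM]
    constructor
    · rintro ⟨W', hW', E', hE', h₁, h₂, z, hz, hzW, q', -, hzq⟩
      obtain ⟨rfl, rfl⟩ := ZFSet.pair_injective hzq
      exact (h₁.iff_starEq hMK hle hσ hγ hzW hq).1 h₂
    · intro hs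
      obtain ⟨W', hW', E', hE', h₁, h₂⟩ := (hW _ (hMK.subset W hWC _ h)).1 h
      exact ⟨W', hW', E', hE', h₁, (h₁.iff_starEq hMK hle hσ hγ h₂ hq).2 hs, _,
        hMK.subset W hWC _ h, h₂, q, hq, rfl⟩
  -- By induction the pairs needed for `(σ, γ)` are already in `W`; adjoining this one pair, with
  -- its value computed from `E`, gives an attempt.
  have hall : ∀ σ ∈ M, ∀ γ ∈ M, ZFSet.pair σ γ ∈ W := by
    intro σ hσ γ hγ
    induction hn : max σ.rank γ.rank using WellFoundedLT.induction generalizing σ γ with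
    | _ n ih =>
    have hM : ∀ {π r}, ZFSet.pair π r ∈ σ ∪ γ → π ∈ M := fun {π r} h =>
      (ZFSet.mem_union.1 h).elim (fun h => (hMK.of_pair_mem_of_mem (.inl hσ) h).1)
        (fun h => (hMK.of_pair_mem_of_mem (.inl hγ) h).1)
    have hpred : ∀ π r, ZFSet.pair π r ∈ σ ∪ γ → ∀ π' r', ZFSet.pair π' r' ∈ σ ∪ γ →
        ZFSet.pair π' π ∈ W := fun π r hπ π' r' hπ' =>
      ih _ (hn ▸ max_rank_lt_of_pair_mem_union hπ hπ') π' (hM hπ') π (hM hπ) rfl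
    have hσγ := hMK.pair_mem hσ hγ
    have hσ₁ : IsTerm c (fun _ => σ) := .param (hr (hMK.mem_cls_of_mem hσ))
    have hγ₁ : IsTerm c (fun _ => γ) := .param (hr (hMK.mem_cls_of_mem hγ))
    obtain ⟨W', hWC', hW'⟩ := Definable.hasClass hMK hc' (A := fun x => x ∈ W ∨ x = ZFSet.pair σ γ)
      (.or (.mem h₀ (.param (hr hWC))) (.eq_pair hMK hc' h₀ hσ₁ hγ₁))
    obtain ⟨E', hEC', hE'⟩ := Definable.hasClass hMK hc'
      (A := fun x => x ∈ E ∨ ∃ q ∈ M, x = ZFSet.pair (ZFSet.pair σ γ) q ∧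
        eqClause le (fun π' π q => ZFSet.pair (ZFSet.pair π' π) q ∈ E) σ γ q)
      (.or (.mem h₀ (.param (hr hEC))) (.exSet (.and
        (.eq_pair hMK hc' (.var (.set 1) fun _ => rfl) (.param (hr (hMK.mem_cls_of_mem hσγ))) h₀)
        (.eqClause hMK hc' (hr hle) (.param (hr hEC)) hσ₁ hγ₁ h₀))))
    have hclause : eqClause le (fun π' π q => ZFSet.pair (ZFSet.pair π' π) q ∈ E) σ γ =
        StarEq le σ γ := by
      rw [starEq_eq, eqClause_congr]
      intro π r hπ π' r' hπ' q s hqs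
      exact hco _ (hM hπ') _ (hM hπ) (hpred π r hπ π' r' hπ') q
        (hMK.of_pair_mem_of_mem (.inr hle) hqs).1
    have hgood : EqAttempt M le W' E' := by
      apply EqAttempt.of_iff_starEq hMK hle
      · intro σ₁ hσ₁ γ₁ hγ₁ h₁ π r hπ π' r' hπ'
        rcases (hW' _ (hMK.pair_mem hσ₁ hγ₁)).1 h₁ with h₁ | h₁
        · have := hcl σ₁ hσ₁ γ₁ hγ₁ h₁ π r hπ π' r' hπ'
          exact (hW' _ (hMK.subset W hWC _ this)).2 (.inl this)
        · obtain ⟨rfl, rfl⟩ := ZFSet.pair_injective h₁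
          have := hpred π r hπ π' r' hπ'
          exact (hW' _ (hMK.subset W hWC _ this)).2 (.inl this)
      · intro σ₁ hσ₁ γ₁ hγ₁ h₁ q hq
        have hσγ₁ := hMK.pair_mem hσ₁ hγ₁
        rw [hE' _ (hMK.pair_mem hσγ₁ hq), hclause]
        beta_reduce
        by_cases hWW : ZFSet.pair σ₁ γ₁ ∈ W
        · rw [hco _ hσ₁ _ hγ₁ hWW q hq]
          refine ⟨?_, .inl⟩
          rintro (h | ⟨q', -, h, h'⟩)
          · exact h
          · obtain ⟨h₂, h₃⟩ := ZFSet.pair_injective h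
            obtain ⟨h₄, h₅⟩ := ZFSet.pair_injective h₂
            rwa [h₃, h₄, h₅]
        -- A pair outside `W` carries no triple of `E`, so only the adjoined value remains.
        · obtain ⟨rfl, rfl⟩ := ZFSet.pair_injective (((hW' _ hσγ₁).1 h₁).resolve_left hWW)
          constructor
          · rintro (h | ⟨q', -, h, h'⟩)
            · obtain ⟨W₂, hW₂, E₂, hE₂, h₂, h₃, z, hz, hzW, q', -, hzq⟩ :=
                (hE _ (hMK.pair_mem hσγ₁ hq)).1 h
              obtain ⟨rfl, rfl⟩ := ZFSet.pair_injective hzq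
              exact absurd ((hW _ hσγ₁).2 ⟨W₂, hW₂, E₂, hE₂, h₂, hzW⟩) hWW
            · obtain ⟨-, rfl⟩ := ZFSet.pair_injective h
              exact h'
          · exact fun h => .inr ⟨q, hq, rfl, h⟩
    exact (hW _ hσγ).2 ⟨W', hWC', E', hEC', hgood, (hW' _ hσγ).2 (.inr rfl)⟩
  exact ⟨E, hEC, fun σ hσ γ hγ => hco σ hσ γ hγ (hall σ hσ γ hγ)⟩

namespace Definable

/-- The class `E` handles equality of sets only. Definability then climbs: a set in a class (here),
equality of classes (`starEq`), and finally a class in a class (`starMem`). -/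
theorem starMem_set (hMK : IsMKModel M C) (hc : Set.range c = C) (hle : le ∈ C)
    {n : ℕ} (hs : ∀ e, s e = e (.set n)) (ht : IsTerm c t) (hw : IsTerm c w) :
    Definable M C c (fun e => StarMem le (s e) (t e) (w e)) := by
  have hc' : ∀ n, c n ∈ C := fun n => hc ▸ ⟨n, rfl⟩
  have hr : ∀ {x}, x ∈ C → x ∈ Set.range c := fun h => hc.symm ▸ h
  obtain ⟨E, hEC, hE⟩ := exists_class_starEq hMK hc hle
  have hs' : IsTerm c s := .var _ hs
  refine (memClause hMK hc' (hr hle) (R := fun e π q => ZFSet.pair (ZFSet.pair π (s e)) q ∈ E)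
    (pair_pair_mem hMK hc' (.var (.set 1) fun _ => rfl) hs'.tailSet.tailSet.tailSet
      (.var (.set 2) fun _ => rfl) (.param (hr hEC))) ht hw).congr fun e he => ?_
  rw [starMem_eq, memClause_congr]
  intro π r hπ q s' hq
  refine (hE _ ?_ _ (hs e ▸ he.1 n) _ ?_).symm
  · exact (hMK.of_pair_mem_of_mem (ht.mem_or_mem hc' he) hπ).1
  · exact (hMK.of_pair_mem_of_mem (.inr hle) hq).1

theorem starEq (hMK : IsMKModel M C) (hc : Set.range c = C) (hle : le ∈ C)
    (hs : IsTerm c s) (ht : IsTerm c t) (hw : IsTerm c w) :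
    Definable M C c (fun e => StarEq le (s e) (t e) (w e)) := by
  have hc' : ∀ n, c n ∈ C := fun n => hc ▸ ⟨n, rfl⟩
  have hr : ∀ {x}, x ∈ C → x ∈ Set.range c := fun h => hc.symm ▸ h
  refine congr (R := fun e => ∀ π r, ZFSet.pair π r ∈ s e ∪ t e →
    ClassForcing.starIff le (StarMem le π (s e)) (StarMem le π (t e)) (w e)) ?_
    fun e he => by rw [StarEq]
  exact forall_pair_mem_union hMK hc' hs ht (starIff hMK hc' (hr hle) hw.tailSet.tailSet
    (starMem_set hMK hc hle (n := 2) (fun _ => rfl) hs.tailSet.tailSet.tailSet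
      (.var (.set 0) fun _ => rfl))
    (starMem_set hMK hc hle (n := 2) (fun _ => rfl) ht.tailSet.tailSet.tailSet
      (.var (.set 0) fun _ => rfl)))

theorem starMem (hMK : IsMKModel M C) (hc : Set.range c = C) (hle : le ∈ C)
    (hs : IsTerm c s) (ht : IsTerm c t) (hw : IsTerm c w) :
    Definable M C c (fun e => StarMem le (s e) (t e) (w e)) := by
  have hc' : ∀ n, c n ∈ C := fun n => hc ▸ ⟨n, rfl⟩
  have hr : ∀ {x}, x ∈ C → x ∈ Set.range c := fun h => hc.symm ▸ h
  refine (memClause hMK hc' (hr hle) (R := fun e π q => StarEq le π (s e) q)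
    (starEq hMK hc hle (.var (.set 1) fun _ => rfl) hs.tailSet.tailSet.tailSet
      (.var (.set 2) fun _ => rfl)) ht hw).congr fun e he => ?_
  rw [starMem_eq]

end Definable

end Atomic

end ClassForcing

namespace ClassForcing

-- The model contains the ranks of its sets.

section Rank

variable {M C : Set ZFSet.{u}} {c : ℕ → ZFSet.{u}}

/-- `F` is closed under the recursion for the rank function, and solves it on its domain. -/
def RankAttempt (M : Set ZFSet.{u}) (F : ZFSet.{u}) : Prop :=
  ∀ y ∈ M, ∀ o ∈ M, ZFSet.pair y o ∈ F →
    (∀ z ∈ M, z ∈ y → ∃ w ∈ M, ZFSet.pair z w ∈ F) ∧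
    ∀ t ∈ M, t ∈ o ↔ ∃ z ∈ M, z ∈ y ∧ ∃ w ∈ M, ZFSet.pair z w ∈ F ∧ (t ∈ w ∨ t = w)

theorem Definable.rankAttempt (hMK : IsMKModel M C) (hc : ∀ n, c n ∈ C)
    {F : (Var → ZFSet.{u}) → ZFSet.{u}} (hF : IsTerm c F) :
    Definable M C c (fun e => RankAttempt M (F e)) := by
  have h₀ : IsTerm c (fun e => e (.set 0)) := .var _ fun _ => rfl
  have h₁ : IsTerm c (fun e => e (.set 1)) := .var _ fun _ => rfl
  refine allSet (allSet (.imp (pair_mem hMK hc h₁ h₀ hF.tailSet.tailSet) (.and ?_ ?_)))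
  · exact allSet (.imp (mem h₀ (.var (.set 2) fun _ => rfl))
      (exSet (pair_mem hMK hc h₁ h₀ hF.tailSet.tailSet.tailSet.tailSet)))
  · exact allSet (.iff (mem h₀ h₁) (exSet (.and (mem h₀ (.var (.set 3) fun _ => rfl))
      (exSet (.and (pair_mem hMK hc h₁ h₀ hF.tailSet.tailSet.tailSet.tailSet.tailSet)
        (.or (mem (.var (.set 2) fun _ => rfl) h₀) (eq (.var (.set 2) fun _ => rfl) h₀)))))))

/-- The recursion `rank y = ⋃ (rank z ∪ {rank z})` over `z ∈ y`, in the form that `RankAttempt`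
imitates. -/
theorem mem_toZFSet_rank {y t : ZFSet.{u}} :
    t ∈ y.rank.toZFSet ↔ ∃ z ∈ y, t ∈ z.rank.toZFSet ∨ t = z.rank.toZFSet := by
  constructor
  · intro h
    obtain ⟨a, ha, rfl⟩ := Ordinal.mem_toZFSet_iff.1 h
    obtain ⟨z, hz, hza⟩ := ZFSet.lt_rank_iff.1 ha
    refine ⟨z, hz, ?_⟩
    rcases hza.lt_or_eq with h | h
    · exact .inl (Ordinal.toZFSet_mem_toZFSet_iff.2 h)
    · exact .inr (by rw [h])
  · rintro ⟨z, hz, h | rfl⟩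
    · exact Ordinal.toZFSet_monotone (ZFSet.rank_lt_of_mem hz).le h
    · exact Ordinal.toZFSet_mem_toZFSet_iff.2 (ZFSet.rank_lt_of_mem hz)

theorem RankAttempt.eq_rank (hMK : IsMKModel M C) {F : ZFSet.{u}} (hF : RankAttempt M F)
    {y o : ZFSet.{u}} (hy : y ∈ M) (ho : o ∈ M) (h : ZFSet.pair y o ∈ F) :
    o = y.rank.toZFSet := by
  induction y using ZFSet.inductionOn generalizing o with
  | _ y ih =>
  obtain ⟨h₁, h₂⟩ := hF y hy o ho h
  ext t
  rw [mem_toZFSet_rank]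
  constructor
  · intro ht
    obtain ⟨z, hz, hzy, w, hw, hzw, htw⟩ := (h₂ t (hMK.transitive o ho t ht)).1 ht
    rw [ih z hzy hz hw hzw] at htw
    exact ⟨z, hzy, htw⟩
  · rintro ⟨z, hzy, htz⟩
    have hz := hMK.transitive y hy z hzy
    obtain ⟨w, hw, hzw⟩ := h₁ z hz hzy
    rw [← ih z hzy hz hw hzw] at htz
    refine (h₂ t ?_).2 ⟨z, hz, hzy, w, hw, hzw, htz⟩
    rcases htz with h | rfl
    exacts [hMK.transitive w hw t h, hw]

theorem RankAttempt.of_eq_rank (hMK : IsMKModel M C) {F : ZFSet.{u}}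
    (h : ∀ y ∈ M, ∀ o ∈ M, ZFSet.pair y o ∈ F → ∀ z ∈ y, ∃ w ∈ M, ZFSet.pair z w ∈ F)
    (h' : ∀ y ∈ M, ∀ o ∈ M, ZFSet.pair y o ∈ F → o = y.rank.toZFSet) : RankAttempt M F := by
  refine fun y hy o ho hyo => ⟨fun z _ hz => h y hy o ho hyo z hz, fun t _ => ?_⟩
  rw [h' y hy o ho hyo, mem_toZFSet_rank]
  constructor
  · rintro ⟨z, hz, ht⟩
    have hzM := hMK.transitive y hy z hz
    obtain ⟨w, hw, hzw⟩ := h y hy o ho hyo z hz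
    rw [← h' z hzM w hw hzw] at ht
    exact ⟨z, hzM, hz, w, hw, hzw, ht⟩
  · rintro ⟨z, hzM, hz, w, hw, hzw, ht⟩
    rw [h' z hzM w hw hzw] at ht
    exact ⟨z, hz, ht⟩

/-- The model contains the ranks of its elements. -/
theorem toZFSet_rank_mem (hMK : IsMKModel M C) (hc : Set.range c = C) {x : ZFSet.{u}}
    (hx : x ∈ M) : x.rank.toZFSet ∈ M := by
  have hc' : ∀ n, c n ∈ C := fun n => hc ▸ ⟨n, rfl⟩
  have hr : ∀ {x}, x ∈ C → x ∈ Set.range c := fun h => hc.symm ▸ h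
  have h₀ : IsTerm c (fun e => e (.set 0)) := .var _ fun _ => rfl
  -- The union of all attempts, cut down to ordered pairs so that replacement applies to it.
  obtain ⟨F, hFC, hF⟩ := Definable.hasClass hMK hc'
    (A := fun x => (∃ F ∈ C, RankAttempt M F ∧ x ∈ F) ∧ ∃ z ∈ M, ∃ w ∈ M, x = ZFSet.pair z w)
    (.and (.exCls (.and (.rankAttempt hMK hc' (.var (.cls 0) fun _ => rfl))
      (.mem h₀ (.var (.cls 0) fun _ => rfl))))
      (.exSet (.exSet (.eq_pair hMK hc' (.var (.set 2) fun _ => rfl) (.var (.set 1) fun _ => rfl)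
        h₀))))
  beta_reduce at hF
  have hcl : ∀ y ∈ M, ∀ o ∈ M, ZFSet.pair y o ∈ F → ∀ z ∈ y, ∃ w ∈ M, ZFSet.pair z w ∈ F := by
    intro y hy o ho hyo z hz
    obtain ⟨⟨F', hF', h, hyo'⟩, -⟩ := (hF _ (hMK.pair_mem hy ho)).1 hyo
    have hzM := hMK.transitive y hy z hz
    obtain ⟨w, hw, hzw⟩ := (h y hy o ho hyo').1 z hzM hz
    exact ⟨w, hw, (hF _ (hMK.pair_mem hzM hw)).2 ⟨⟨F', hF', h, hzw⟩, z, hzM, w, hw, rfl⟩⟩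
  have hco : ∀ y ∈ M, ∀ o ∈ M, ZFSet.pair y o ∈ F → o = y.rank.toZFSet := by
    intro y hy o ho hyo
    obtain ⟨⟨F', hF', h, hyo'⟩, -⟩ := (hF _ (hMK.pair_mem hy ho)).1 hyo
    exact h.eq_rank hMK hy ho hyo'
  have hco' : ∀ y o, ZFSet.pair y o ∈ F → o = y.rank.toZFSet := fun y o h =>
    hco y (hMK.of_pair_mem_of_mem (.inr hFC) h).1 o (hMK.of_pair_mem_of_mem (.inr hFC) h).2 h
  suffices h : ∃ o ∈ M, ZFSet.pair x o ∈ F by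
    obtain ⟨o, ho, h⟩ := h
    exact hco x hx o ho h ▸ ho
  induction x using ZFSet.inductionOn with
  | _ y ih =>
  have hym : ∀ z ∈ y, z ∈ M := hMK.transitive y hx
  have hyF : ∀ z ∈ y, ZFSet.pair z z.rank.toZFSet ∈ F := fun z hz => by
    obtain ⟨o, ho, h⟩ := ih z hz (hym z hz)
    rwa [← hco z (hym z hz) o ho h]
  -- `r` is the set of ranks of members of `y`; the rank of `y` is `r ∪ ⋃ r`, which is `o` below.
  obtain ⟨r, hrM, hrr⟩ := hMK.replacement F hFC
    (fun w hw => by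
      obtain ⟨z, -, w', -, h⟩ := ((hF w (hMK.subset F hFC w hw)).1 hw).2
      exact ⟨z, w', h⟩)
    (fun z y y' h h' => by rw [hco' _ _ h, hco' _ _ h']) y hx
  obtain ⟨U, hUM, hU⟩ := hMK.union r hrM
  obtain ⟨o, hoM, ho⟩ := hMK.union _ (hMK.insert_singleton_mem hrM hUM)
  have hrank : ∀ z ∈ y, z.rank.toZFSet ∈ r := fun z hz =>
    (hrr _ (hMK.of_pair_mem_of_mem (.inr hFC) (hyF z hz)).2).2 ⟨z, hz, hyF z hz⟩
  have hoy : o = y.rank.toZFSet := by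
    ext t
    rw [mem_toZFSet_rank]
    constructor
    · intro ht
      obtain ⟨x, hx, htx⟩ := (ho t (hMK.transitive o hoM t ht)).1 ht
      rcases ZFSet.mem_pair.1 hx with rfl | rfl
      · obtain ⟨z, hz, h⟩ := (hrr t (hMK.transitive x hrM t htx)).1 htx
        exact ⟨z, hz, .inr (hco' _ _ h)⟩
      · obtain ⟨w, hw, htw⟩ := (hU t (hMK.transitive x hUM t htx)).1 htx
        obtain ⟨z, hz, h⟩ := (hrr w (hMK.transitive r hrM w hw)).1 hw
        exact ⟨z, hz, .inl (hco' _ _ h ▸ htw)⟩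
    · rintro ⟨z, hz, h | rfl⟩
      · have ht := hMK.transitive _ (hMK.transitive r hrM _ (hrank z hz)) t h
        exact (ho t ht).2 ⟨U, by simp, (hU t ht).2 ⟨_, hrank z hz, h⟩⟩
      · exact (ho _ (hMK.transitive r hrM _ (hrank z hz))).2 ⟨r, by simp, hrank z hz⟩
  have hyo := hMK.pair_mem hx hoM
  obtain ⟨F', hFC', hF'⟩ := Definable.hasClass hMK hc' (A := fun x => x ∈ F ∨ x = ZFSet.pair y o)
    (.or (.mem h₀ (.param (hr hFC))) (.eq_pair hMK hc' h₀ (.param (hr (hMK.mem_cls_of_mem hx)))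
      (.param (hr (hMK.mem_cls_of_mem hoM)))))
  beta_reduce at hF'
  have hsub : ∀ {z w}, ZFSet.pair z w ∈ F → ZFSet.pair z w ∈ F' := fun h =>
    (hF' _ (hMK.subset F hFC _ h)).2 (.inl h)
  refine ⟨o, hoM, (hF _ hyo).2 ⟨⟨F', hFC', ?_, (hF' _ hyo).2 (.inr rfl)⟩, y, hx, o, hoM, rfl⟩⟩
  apply RankAttempt.of_eq_rank hMK
  · intro y₁ hy₁ o₁ ho₁ h₁ z hz
    rcases (hF' _ (hMK.pair_mem hy₁ ho₁)).1 h₁ with h | h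
    · obtain ⟨w, hw, h⟩ := hcl y₁ hy₁ o₁ ho₁ h z hz
      exact ⟨w, hw, hsub h⟩
    · obtain ⟨rfl, rfl⟩ := ZFSet.pair_injective h
      exact ⟨_, (hMK.of_pair_mem_of_mem (.inr hFC) (hyF z hz)).2, hsub (hyF z hz)⟩
  · intro y₁ hy₁ o₁ ho₁ h₁
    rcases (hF' _ (hMK.pair_mem hy₁ ho₁)).1 h₁ with h | h
    · exact hco' _ _ h
    · obtain ⟨rfl, rfl⟩ := ZFSet.pair_injective h
      exact hoy

end Rank

-- Set-names and class-names are definable, and so is star-forcing.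

section Names

variable {M C : Set ZFSet.{u}} {c : ℕ → ZFSet.{u}} {P le : ZFSet.{u}}

/-- One description for zero, successor and limit levels, from which monotonicity is immediate. The
successor case needs the induction hypothesis to lift a name from an earlier level. -/
theorem mem_setNamesAt {σ : ZFSet.{u}} {α : Ordinal.{u}} :
    σ ∈ setNamesAt M P α ↔ ∃ β < α, σ ∈ M ∧
      ∀ x ∈ σ, ∃ π ∈ setNamesAt M P β, ∃ r ∈ P, x = ZFSet.pair π r := by
  induction α using WellFoundedLT.induction generalizing σ with
  | _ α ih =>
  rcases Ordinal.zero_or_succ_or_isSuccLimit α with rfl | ⟨β, rfl⟩ | hα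
  · simp [setNamesAt]
  · have : setNamesAt M P (Order.succ β) =
        {σ | σ ∈ M ∧ ∀ x ∈ σ, ∃ π ∈ setNamesAt M P β, ∃ r ∈ P, x = ZFSet.pair π r} := by
      rw [Order.succ_eq_add_one]
      simp only [setNamesAt, Ordinal.limitRecOn_add_one]
    rw [this]
    refine ⟨fun h => ⟨β, Order.lt_succ β, h⟩, ?_⟩
    rintro ⟨γ, hγ, hσ, h⟩
    refine ⟨hσ, fun x hx => ?_⟩
    obtain ⟨π, hπ, r, hr, rfl⟩ := h x hx
    refine ⟨π, ?_, r, hr, rfl⟩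
    obtain ⟨δ, hδ, h⟩ := (ih γ hγ).1 hπ
    exact (ih β (Order.lt_succ β)).2 ⟨δ, hδ.trans_le (Order.lt_succ_iff.1 hγ), h⟩
  · have : setNamesAt M P α = {σ | ∃ β < α, σ ∈ setNamesAt M P β} := by
      rw [setNamesAt, Ordinal.limitRecOn_limit _ _ _ _ hα]
      simp only [setNamesAt, exists_prop]
    rw [this]
    constructor
    · rintro ⟨β, hβ, h⟩
      obtain ⟨γ, hγ, h⟩ := (ih β hβ).1 h
      exact ⟨γ, hγ.trans hβ, h⟩
    · rintro ⟨β, hβ, h⟩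
      exact ⟨_, hα.succ_lt hβ, (ih _ (hα.succ_lt hβ)).2 ⟨β, Order.lt_succ β, h⟩⟩

theorem setNamesAt_mono {α β : Ordinal.{u}} (h : α ≤ β) :
    setNamesAt M P α ⊆ setNamesAt M P β := fun _ hσ => by
  obtain ⟨γ, hγ, H⟩ := mem_setNamesAt.1 hσ
  exact mem_setNamesAt.2 ⟨γ, hγ.trans_le h, H⟩

theorem mem_setNamesAt_rank {σ : ZFSet.{u}} {α : Ordinal.{u}} (h : σ ∈ setNamesAt M P α) :
    σ ∈ setNamesAt M P (Order.succ σ.rank) := by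
  induction hn : σ.rank using WellFoundedLT.induction generalizing σ α with
  | _ n ih =>
  obtain ⟨β, -, hσ, H⟩ := mem_setNamesAt.1 h
  refine mem_setNamesAt.2 ⟨n, Order.lt_succ n, hσ, fun x hx => ?_⟩
  obtain ⟨π, hπ, r, hr, rfl⟩ := H x hx
  have hlt := hn ▸ rank_lt_of_pair_mem hx
  exact ⟨π, setNamesAt_mono (Order.succ_le_of_lt hlt) (ih _ hlt hπ rfl), r, hr, rfl⟩

/-- A description without levels. For the converse, all names inside `σ` must fit into one level
indexed in `M`: a name appears by the successor of its own rank, so level `rank σ` contains them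
all. -/
theorem mem_setNames (hMK : IsMKModel M C) (hc : Set.range c = C) {σ : ZFSet.{u}} :
    σ ∈ setNames M P ↔ σ ∈ M ∧ ∀ x ∈ σ, ∃ π ∈ setNames M P, ∃ r ∈ P, x = ZFSet.pair π r := by
  constructor
  · rintro ⟨α, hα, h⟩
    obtain ⟨β, hβ, hσ, H⟩ := mem_setNamesAt.1 h
    refine ⟨hσ, fun x hx => ?_⟩
    obtain ⟨π, hπ, r, hr, rfl⟩ := H x hx
    exact ⟨π, ⟨β, hMK.transitive _ hα _ (Ordinal.toZFSet_mem_toZFSet_iff.2 hβ), hπ⟩, r, hr, rfl⟩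
  · rintro ⟨hσ, H⟩
    refine ⟨Order.succ σ.rank, ?_, mem_setNamesAt.2 ⟨σ.rank, Order.lt_succ _, hσ, fun x hx => ?_⟩⟩
    -- The successor of the rank of `σ` is the rank of `{σ}`, a set in `M`.
    · rw [← ZFSet.rank_singleton]
      exact toZFSet_rank_mem hMK hc (hMK.singleton_mem hσ)
    · obtain ⟨π, ⟨α, -, hπ⟩, r, hr, rfl⟩ := H x hx
      exact ⟨π, setNamesAt_mono (Order.succ_le_of_lt (rank_lt_of_pair_mem hx))
        (mem_setNamesAt_rank hπ), r, hr, rfl⟩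

/-- `W` is a collection of names containing all names occurring in its members. -/
def NamesAttempt (M : Set ZFSet.{u}) (P W : ZFSet.{u}) : Prop :=
  ∀ σ ∈ M, σ ∈ W → ∀ x ∈ M, x ∈ σ → ∃ π ∈ M, π ∈ W ∧ ∃ r ∈ M, r ∈ P ∧ x = ZFSet.pair π r

theorem Definable.namesAttempt (hMK : IsMKModel M C) (hc : ∀ n, c n ∈ C) (hP : P ∈ Set.range c)
    {W : (Var → ZFSet.{u}) → ZFSet.{u}} (hW : IsTerm c W) :
    Definable M C c (fun e => NamesAttempt M P (W e)) := by
  have h₀ : IsTerm c (fun e => e (.set 0)) := .var _ fun _ => rfl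
  have h₁ : IsTerm c (fun e => e (.set 1)) := .var _ fun _ => rfl
  exact allSet (.imp (mem h₀ hW.tailSet) (allSet (.imp (mem h₀ h₁) (exSet (.and
    (mem h₀ hW.tailSet.tailSet.tailSet) (exSet (.and (mem h₀ (.param hP))
      (eq_pair hMK hc (.var (.set 2) fun _ => rfl) h₁ h₀))))))))

/-- The set-names form a class. -/
theorem hasClass_setNames (hMK : IsMKModel M C) (hc : Set.range c = C) (hP : P ∈ C) :
    HasClass M C (· ∈ setNames M P) := by
  have hc' : ∀ n, c n ∈ C := fun n => hc ▸ ⟨n, rfl⟩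
  have hr : ∀ {x}, x ∈ C → x ∈ Set.range c := fun h => hc.symm ▸ h
  have h₀ : IsTerm c (fun e => e (.set 0)) := .var _ fun _ => rfl
  -- The largest self-supporting collection; well-foundedness of membership forces it to coincide
  -- with the inductively built names.
  obtain ⟨W, hWC, hW⟩ := Definable.hasClass hMK hc'
    (A := fun x => ∃ W ∈ C, NamesAttempt M P W ∧ x ∈ W)
    (.exCls (.and (.namesAttempt hMK hc' (hr hP) (.var (.cls 0) fun _ => rfl))
      (.mem h₀ (.var (.cls 0) fun _ => rfl))))
  beta_reduce at hW
  refine ⟨W, hWC, fun σ hσ => ⟨fun h => ?_, fun h => ?_⟩⟩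
  · obtain ⟨W', hWC', hW', h⟩ := (hW σ hσ).1 h
    induction hn : σ.rank using WellFoundedLT.induction generalizing σ with
    | _ n ih =>
    refine (mem_setNames hMK hc).2 ⟨hσ, fun x hx => ?_⟩
    obtain ⟨π, hπ, hπW, r, hr, hrP, rfl⟩ := hW' σ hσ h x (hMK.transitive σ hσ x hx) hx
    refine ⟨π, ?_, r, hrP, rfl⟩
    exact ih _ (hn ▸ rank_lt_of_pair_mem hx) π hπ ((hW π hπ).2 ⟨W', hWC', hW', hπW⟩) hπW rfl
  · induction hn : σ.rank using WellFoundedLT.induction generalizing σ with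
    | _ n ih =>
    obtain ⟨W', hWC', hW'⟩ := Definable.hasClass hMK hc' (A := fun x => x ∈ W ∨ x = σ)
      (.or (.mem h₀ (.param (hr hWC))) (.eq h₀ (.param (hr (hMK.mem_cls_of_mem hσ)))))
    beta_reduce at hW'
    refine (hW σ hσ).2 ⟨W', hWC', fun τ hτ hτW x hx hxτ => ?_, (hW' σ hσ).2 (.inr rfl)⟩
    rcases (hW' τ hτ).1 hτW with hτW | rfl
    · obtain ⟨W₁, hWC₁, hW₁, h₁⟩ := (hW τ hτ).1 hτW
      obtain ⟨π, hπ, hπW, H⟩ := hW₁ τ hτ h₁ x hx hxτ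
      exact ⟨π, hπ, (hW' π hπ).2 (.inl ((hW π hπ).2 ⟨W₁, hWC₁, hW₁, hπW⟩)), H⟩
    · obtain ⟨π, hπ, r, hr, rfl⟩ := ((mem_setNames hMK hc).1 h).2 x hxτ
      have hM := hMK.of_pair_mem hx
      exact ⟨π, hM.1, (hW' π hM.1).2 (.inl (ih _ (hn ▸ rank_lt_of_pair_mem hxτ) π hM.1 hπ rfl)),
        r, hM.2, hr, rfl⟩

theorem setNames_subset (hMK : IsMKModel M C) (hc : Set.range c = C) : setNames M P ⊆ M :=
  fun _ h => ((mem_setNames hMK hc).1 h).1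

namespace Definable

variable {t : (Var → ZFSet.{u}) → ZFSet.{u}}

theorem mem_setNames (hMK : IsMKModel M C) (hc : Set.range c = C) (hP : P ∈ C) (n : ℕ) :
    Definable M C c (fun e => e (.set n) ∈ setNames M P) := by
  obtain ⟨N, hN, h⟩ := hasClass_setNames hMK hc hP
  have h' : Definable M C c (fun e => e (.set n) ∈ N) :=
    .mem (.var (.set n) fun _ => rfl) (.param (hc.symm ▸ hN))
  exact h'.congr fun e he => (h _ (he.1 n)).symm

theorem mem_classNames (hMK : IsMKModel M C) (hc : Set.range c = C) (hP : P ∈ C) (n : ℕ) :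
    Definable M C c (fun e => e (.cls n) ∈ classNames M C P) := by
  have hc' : ∀ n, c n ∈ C := fun n => hc ▸ ⟨n, rfl⟩
  have h : Definable M C c (fun e => ∀ x ∈ M, x ∈ e (.cls n) →
      ∃ π ∈ M, π ∈ setNames M P ∧ ∃ r ∈ M, r ∈ P ∧ x = ZFSet.pair π r) :=
    .allSet (.imp (.mem (.var (.set 0) fun _ => rfl) (.var (.cls n) fun _ => rfl))
      (.exSet (.and (mem_setNames hMK hc hP 0) (.exSet (.and
        (.mem (.var (.set 0) fun _ => rfl) (.param (hc.symm ▸ hP)))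
        (.eq_pair hMK hc' (.var (.set 2) fun _ => rfl) (.var (.set 1) fun _ => rfl)
          (.var (.set 0) fun _ => rfl)))))))
  refine h.congr fun e he => ⟨fun ⟨_, h⟩ x _ hx => ?_, fun h => ⟨he.2 n, fun x hx => ?_⟩⟩
  · obtain ⟨π, hπ, r, hr, rfl⟩ := h x hx
    exact ⟨π, setNames_subset hMK hc hπ, hπ, r, hMK.subset P hP r hr, hr, rfl⟩
  · obtain ⟨π, -, hπ, r, -, hr, rfl⟩ := h x (hMK.subset _ (he.2 n) x hx) hx
    exact ⟨π, hπ, r, hr, rfl⟩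

/-- Definability of star-forcing. -/
theorem forcesStar (hMK : IsMKModel M C) (hc : Set.range c = C) (hP : P ∈ C) (hle : le ∈ C)
    (φ : Formula) (f : Var → Var) (ht : IsTerm c t) :
    Definable M C c (fun e => ForcesStar M C P le φ (fun a => e (f a)) (t e)) := by
  have hc' : ∀ n, c n ∈ C := fun n => hc ▸ ⟨n, rfl⟩
  have hr : ∀ {x}, x ∈ C → x ∈ Set.range c := fun h => hc.symm ▸ h
  have h₀ : IsTerm c (fun e => e (.set 0)) := .var _ fun _ => rfl
  -- `f` records where each variable of the formula sits in the environment. A quantifier puts its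
  -- variable at position `0` and shifts the rest, so `f` must vary in the induction.
  induction φ generalizing f t with
  | mem a b => exact starMem hMK hc hle (.var (f a) fun _ => rfl) (.var (f b) fun _ => rfl) ht
  | eq a b => exact starEq hMK hc hle (.var (f a) fun _ => rfl) (.var (f b) fun _ => rfl) ht
  | and φ ψ h₁ h₂ => exact (h₁ f ht).and (h₂ f ht)
  | neg φ h =>
    exact starNeg hMK hc' (hr hle) ht (A := fun e => ForcesStar M C P le φ fun a => e (f a))
      (h (Var.map (· + 1) id ∘ f) h₀)
  | allSet n φ h =>
    have h₁ : Definable M C c (fun e => ∀ σ ∈ M, σ ∈ setNames M P →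
        ForcesStar M C P le φ (Function.update (fun a => e (f a)) (.set n) σ) (t e)) := by
      refine .allSet ((mem_setNames hMK hc hP 0).imp ?_)
      refine (h (Function.update (Var.map (· + 1) id ∘ f) (.set n) (.set 0)) ht.tailSet).congr
        fun e _ => ?_
      rw [show (fun a => e (Function.update (Var.map (· + 1) id ∘ f) (.set n) (.set 0) a)) =
        _ from Function.comp_update e _ _ _]
      rfl
    exact h₁.congr fun e _ => ⟨fun h σ _ hσ => h σ hσ,
      fun h σ hσ => h σ (setNames_subset hMK hc hσ) hσ⟩
  | allCls n φ h =>
    have h₁ : Definable M C c (fun e => ∀ S ∈ C, S ∈ classNames M C P →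
        ForcesStar M C P le φ (Function.update (fun a => e (f a)) (.cls n) S) (t e)) := by
      refine .allCls ((mem_classNames hMK hc hP 0).imp ?_)
      refine (h (Function.update (Var.map id (· + 1) ∘ f) (.cls n) (.cls 0)) ht.tailCls).congr
        fun e _ => ?_
      rw [show (fun a => e (Function.update (Var.map id (· + 1) ∘ f) (.cls n) (.cls 0) a)) =
        _ from Function.comp_update e _ _ _]
      rfl
    exact h₁.congr fun e _ => ⟨fun h S _ hS => h S hS, fun h S hS => h S hS.1 hS⟩

end Definable

end Names

end ClassForcing

namespace ClassForcing

variable {M C : Set ZFSet.{u}} {c : ℕ → ZFSet.{u}} {P le G : ZFSet.{u}}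

-- Existence and basic properties of generic filters.

section Generic

theorem IsForcing.mem_left (hP : IsForcing C P le) {p q : ZFSet.{u}} (h : ZFSet.pair p q ∈ le) :
    p ∈ P := (ZFSet.pair_mem_prod.1 (hP.le_subset h)).1

theorem IsForcing.mem_right (hP : IsForcing C P le) {p q : ZFSet.{u}} (h : ZFSet.pair p q ∈ le) :
    q ∈ P := (ZFSet.pair_mem_prod.1 (hP.le_subset h)).2

/-- Every condition lies in a generic filter. -/
theorem exists_isGeneric (hc : Set.range c = C) (hP : IsForcing C P le) {p : ZFSet.{u}}
    (hp : p ∈ P) : ∃ G, IsGeneric C P le G ∧ p ∈ G := by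
  have hstep : ∀ (n : ℕ) (q : {x // x ∈ P}), ∃ r : {x // x ∈ P}, ZFSet.pair r.1 q.1 ∈ le ∧
      (IsDense P le (c n) → r.1 ∈ c n) := by
    intro n q
    by_cases h : IsDense P le (c n)
    · obtain ⟨r, hr, hrq⟩ := h.2 q.1 q.2
      exact ⟨⟨r, h.1 hr⟩, hrq, fun _ => hr⟩
    · exact ⟨q, hP.refl q.1 q.2, fun h' => absurd h' h⟩
  choose step hle hmem using hstep
  -- A descending sequence from `p` whose step `n` enters `c n` if that class is dense; so the
  -- witness for `c n` is `s (n + 1)`. The filter is its upward closure.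
  let s : ℕ → {x // x ∈ P} := fun n => Nat.rec ⟨p, hp⟩ step n
  have hanti : ∀ m n, m ≤ n → ZFSet.pair (s n).1 (s m).1 ∈ le := by
    intro m n h
    induction h with
    | refl => exact hP.refl _ (s m).2
    | step _ ih => exact hP.trans _ _ _ (hle _ (s _)) ih
  refine ⟨ZFSet.sep (fun x => ∃ n, ZFSet.pair (s n).1 x ∈ le) P,
    ⟨ZFSet.sep_subset, ?_, ?_, ?_⟩, ?_⟩
  · intro q hq r hr
    obtain ⟨-, m, hm⟩ := ZFSet.mem_sep.1 hq
    obtain ⟨-, n, hn⟩ := ZFSet.mem_sep.1 hr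
    exact ⟨_, (s (max m n)).2, hP.trans _ _ _ (hanti m _ (le_max_left _ _)) hm,
      hP.trans _ _ _ (hanti n _ (le_max_right _ _)) hn⟩
  · intro q hq r hr hrq
    obtain ⟨-, n, hn⟩ := ZFSet.mem_sep.1 hr
    exact ZFSet.mem_sep.2 ⟨hq, n, hP.trans _ _ _ hn hrq⟩
  · intro D hD hdense
    obtain ⟨n, rfl⟩ := (hc.symm ▸ hD : D ∈ Set.range c)
    exact ⟨(s (n + 1)).1, ZFSet.mem_sep.2 ⟨(s (n + 1)).2, n + 1, hP.refl _ (s (n + 1)).2⟩,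
      hmem n (s n) hdense⟩
  · exact ZFSet.mem_sep.2 ⟨hp, 0, hP.refl p hp⟩

/-- Adding the conditions incompatible with `p` turns a class dense below `p` into a dense one. A
filter containing `p` cannot meet the added part. -/
theorem HasClass.or_forall_not (hMK : IsMKModel M C) (hc : Set.range c = C) (hle : le ∈ C)
    {A : ZFSet.{u} → Prop} (h : HasClass M C A) {p : ZFSet.{u}} (hp : p ∈ M) :
    HasClass M C (fun q => A q ∨ ∀ r, ZFSet.pair r q ∈ le → ZFSet.pair r p ∉ le) := by
  have hc' : ∀ n, c n ∈ C := fun n => hc ▸ ⟨n, rfl⟩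
  have hr : ∀ {x}, x ∈ C → x ∈ Set.range c := fun h => hc.symm ▸ h
  have h₀ : IsTerm c (fun e => e (.set 0)) := .var _ fun _ => rfl
  obtain ⟨Y, hY, h⟩ := h
  obtain ⟨Z, hZ, h'⟩ := Definable.hasClass hMK hc'
    (A := fun q => q ∈ Y ∨ ∀ r, ZFSet.pair r q ∈ le → ZFSet.pair r p ∉ le)
    (.or (.mem h₀ (.param (hr hY))) (.forall_le hMK hc' (hr hle) h₀
      (.not (.pair_mem hMK hc' h₀ (.param (hr (hMK.mem_cls_of_mem hp))) (.param (hr hle))))))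
  exact ⟨Z, hZ, fun x hx => (h' x hx).trans (or_congr_left (h x hx))⟩

/-- A generic filter meets every class of conditions that is dense below one of its elements. -/
theorem IsGeneric.exists_of_denseBelow (hMK : IsMKModel M C) (hc : Set.range c = C)
    (hP : IsForcing C P le) (hG : IsGeneric C P le G) {A : ZFSet.{u} → Prop}
    (hA : HasClass M C A) {p : ZFSet.{u}} (hp : p ∈ G) (h : DenseBelow le A p) :
    ∃ q ∈ G, A q := by
  have hc' : ∀ n, c n ∈ C := fun n => hc ▸ ⟨n, rfl⟩
  have hPM := hMK.subset P hP.carrier_mem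
  have h₀ : IsTerm c (fun e => e (.set 0)) := .var _ fun _ => rfl
  obtain ⟨Y, hY, hY'⟩ := hA.or_forall_not hMK hc hP.le_mem (hPM p (hG.subset hp))
  obtain ⟨D, hD, hD'⟩ := Definable.hasClass hMK hc' (A := fun q => q ∈ P ∧ q ∈ Y)
    (.and (.mem h₀ (.param (hc.symm ▸ hP.carrier_mem))) (.mem h₀ (.param (hc.symm ▸ hY))))
  beta_reduce at hD'
  have hdense : IsDense P le D := by
    refine ⟨fun q hq => ((hD' q (hMK.subset D hD q hq)).1 hq).1, fun q hq => ?_⟩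
    by_cases hcomp : ∃ r, ZFSet.pair r q ∈ le ∧ ZFSet.pair r p ∈ le
    · obtain ⟨r, hrq, hrp⟩ := hcomp
      obtain ⟨s, hsr, hs⟩ := h r hrp
      have hsP := hP.mem_left hsr
      have hsM := hPM s hsP
      exact ⟨s, (hD' s hsM).2 ⟨hsP, (hY' s hsM).2 (.inl hs)⟩, hP.trans _ _ _ hsr hrq⟩
    · push Not at hcomp
      have hqM := hPM q hq
      exact ⟨q, (hD' q hqM).2 ⟨hq, (hY' q hqM).2 (.inr hcomp)⟩, hP.refl q hq⟩
  obtain ⟨q, hqG, hqD⟩ := hG.meets_dense D hD hdense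
  have hqM := hPM q (hG.subset hqG)
  rcases (hY' q hqM).1 ((hD' q hqM).1 hqD).2 with hq | hq
  · exact ⟨q, hqG, hq⟩
  · obtain ⟨r, -, hrq, hrp⟩ := hG.compatible q hqG p hp
    exact absurd hrp (hq r hrq)

/-- Compatibility only gives a lower bound in `P`. To find one in `G`, note that the conditions
below both `p` and `q`, or incompatible with `q`, are dense below `p`. -/
theorem IsGeneric.directed (hMK : IsMKModel M C) (hc : Set.range c = C)
    (hP : IsForcing C P le) (hG : IsGeneric C P le G) {p q : ZFSet.{u}} (hp : p ∈ G)
    (hq : q ∈ G) : ∃ r ∈ G, ZFSet.pair r p ∈ le ∧ ZFSet.pair r q ∈ le := by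
  have hc' : ∀ n, c n ∈ C := fun n => hc ▸ ⟨n, rfl⟩
  have hr : ∀ {x}, x ∈ C → x ∈ Set.range c := fun h => hc.symm ▸ h
  have hPM := hMK.subset P hP.carrier_mem
  have hpM := hPM p (hG.subset hp)
  have hqM := hPM q (hG.subset hq)
  have h₀ : IsTerm c (fun e => e (.set 0)) := .var _ fun _ => rfl
  have hA : HasClass M C (fun r => ZFSet.pair r p ∈ le ∧ ZFSet.pair r q ∈ le) :=
    Definable.hasClass hMK hc' (.and
      (.pair_mem hMK hc' h₀ (.param (hr (hMK.mem_cls_of_mem hpM))) (.param (hr hP.le_mem)))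
      (.pair_mem hMK hc' h₀ (.param (hr (hMK.mem_cls_of_mem hqM))) (.param (hr hP.le_mem))))
  obtain ⟨r, hrG, h | h⟩ := hG.exists_of_denseBelow hMK hc hP
    (hA.or_forall_not hMK hc hP.le_mem hqM) hp (by
      intro r hrp
      by_cases hcomp : ∃ s, ZFSet.pair s r ∈ le ∧ ZFSet.pair s q ∈ le
      · obtain ⟨s, hsr, hsq⟩ := hcomp
        exact ⟨s, hsr, .inl ⟨hP.trans _ _ _ hsr hrp, hsq⟩⟩
      · push Not at hcomp
        exact ⟨r, hP.refl r (hP.mem_left hrp), .inr hcomp⟩)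
  · exact ⟨r, hrG, h⟩
  · obtain ⟨s, -, hsr, hsq⟩ := hG.compatible r hrG q hq
    exact absurd hsq (h s hsr)

end Generic

-- Regularity of star-forced statements.

section Regular

/-- A collection of conditions that is downward closed and contains every condition below which
it is dense. -/
structure IsRegular (le : ZFSet.{u}) (A : ZFSet.{u} → Prop) : Prop where
  down : ∀ p q, ZFSet.pair q p ∈ le → A p → A q
  of_denseBelow : ∀ p, DenseBelow le A p → A p

variable {A B : ZFSet.{u} → Prop}

theorem DenseBelow.isRegular (hP : IsForcing C P le) : IsRegular le (DenseBelow le A) where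
  down p q hqp h r hrq := h r (hP.trans _ _ _ hrq hqp)
  of_denseBelow p h q hqp := by
    obtain ⟨r, hrq, h'⟩ := h q hqp
    obtain ⟨s, hsr, hs⟩ := h' r (hP.refl r (hP.mem_left hrq))
    exact ⟨s, hP.trans _ _ _ hsr hrq, hs⟩

theorem IsRegular.starNeg (hP : IsForcing C P le) (hA : IsRegular le A) :
    IsRegular le (starNeg le A) where
  down p q hqp h r hrq := h r (hP.trans _ _ _ hrq hqp)
  of_denseBelow p h q hqp hq := by
    obtain ⟨r, hrq, hr⟩ := h q hqp
    exact hr r (hP.refl r (hP.mem_left hrq)) (hA.down q r hrq hq)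

theorem IsRegular.starAnd (hA : IsRegular le A) (hB : IsRegular le B) :
    IsRegular le (starAnd A B) where
  down p q hqp h := ⟨hA.down p q hqp h.1, hB.down p q hqp h.2⟩
  of_denseBelow p h :=
    ⟨hA.of_denseBelow p fun q hq => (h q hq).imp fun _ h => ⟨h.1, h.2.1⟩,
      hB.of_denseBelow p fun q hq => (h q hq).imp fun _ h => ⟨h.1, h.2.2⟩⟩

theorem IsRegular.forall {ι : Sort*} {A : ι → ZFSet.{u} → Prop} (h : ∀ i, IsRegular le (A i)) :
    IsRegular le (fun p => ∀ i, A i p) where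
  down p q hqp hp i := (h i).down p q hqp (hp i)
  of_denseBelow p hp i := (h i).of_denseBelow p fun q hq => (hp q hq).imp fun _ h => ⟨h.1, h.2 i⟩

theorem IsRegular.starIff (hP : IsForcing C P le) (hA : IsRegular le A) (hB : IsRegular le B) :
    IsRegular le (starIff le A B) :=
  ((hA.starAnd (hB.starNeg hP)).starNeg hP).starAnd ((hB.starAnd (hA.starNeg hP)).starNeg hP)

theorem isRegular_starMem (hP : IsForcing C P le) (σ γ : ZFSet.{u}) :
    IsRegular le (StarMem le σ γ) := by
  rw [starMem_eq]
  exact DenseBelow.isRegular hP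

theorem isRegular_starEq (hP : IsForcing C P le) (σ γ : ZFSet.{u}) :
    IsRegular le (StarEq le σ γ) := by
  rw [show StarEq le σ γ = fun p => ∀ π r, ZFSet.pair π r ∈ σ ∪ γ →
    starIff le (StarMem le π σ) (StarMem le π γ) p by funext p; rw [StarEq]]
  exact .forall fun π => .forall fun r => .forall fun _ =>
    (isRegular_starMem hP π σ).starIff hP (isRegular_starMem hP π γ)

/-- Membership is a `DenseBelow` clause, regular by transitivity of the order, and every other
clause preserves regularity. -/
theorem isRegular_forcesStar (hP : IsForcing C P le) (φ : Formula) (v : Var → ZFSet.{u}) :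
    IsRegular le (ForcesStar M C P le φ v) := by
  induction φ generalizing v with
  | mem a b => exact isRegular_starMem hP _ _
  | eq a b => exact isRegular_starEq hP _ _
  | and φ ψ h₁ h₂ => exact (h₁ v).starAnd (h₂ v)
  | neg φ h => exact (h v).starNeg hP
  | allSet n φ h => exact .forall fun σ => .forall fun _ => h _
  | allCls n φ h => exact .forall fun σ => .forall fun _ => h _

/-- A regular collection that omits `p` is excluded by some condition below `p`. -/
theorem IsRegular.exists_starNeg (hA : IsRegular le A) {p : ZFSet.{u}} (h : ¬ A p) :
    ∃ q, ZFSet.pair q p ∈ le ∧ ClassForcing.starNeg le A q := by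
  have := mt (hA.of_denseBelow p) h
  unfold DenseBelow at this
  push Not at this
  exact this

end Regular

-- The truth lemma for connectives and for membership.

section Truth

/-- `A` is a regular class of conditions which the filter `G` meets if and only if `X`. -/
structure Decides (M C : Set ZFSet.{u}) (le G : ZFSet.{u}) (A : ZFSet.{u} → Prop) (X : Prop) :
    Prop where
  regular : IsRegular le A
  hasClass : HasClass M C A
  iff : (∃ p ∈ G, A p) ↔ X

variable {A B : ZFSet.{u} → Prop} {X Y : Prop}

theorem HasClass.starNeg (hMK : IsMKModel M C) (hc : Set.range c = C) (hle : le ∈ C)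
    (h : HasClass M C A) : HasClass M C (starNeg le A) := by
  have hc' : ∀ n, c n ∈ C := fun n => hc ▸ ⟨n, rfl⟩
  have hr : ∀ {x}, x ∈ C → x ∈ Set.range c := fun h => hc.symm ▸ h
  have h₀ : IsTerm c (fun e => e (.set 0)) := .var _ fun _ => rfl
  obtain ⟨Y, hY, h⟩ := h
  obtain ⟨Z, hZ, h'⟩ := Definable.hasClass hMK hc' (A := ClassForcing.starNeg le (· ∈ Y))
    (.starNeg hMK hc' (hr hle) h₀ (A := fun _ q => q ∈ Y) (.mem h₀ (.param (hr hY))))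
  refine ⟨Z, hZ, fun x hx => (h' x hx).trans (forall₂_congr fun q hq => ?_)⟩
  exact not_congr (h q (hMK.of_pair_mem_of_mem (.inr hle) hq).1)

theorem HasClass.and (hMK : IsMKModel M C) (hc : Set.range c = C)
    (hA : HasClass M C A) (hB : HasClass M C B) : HasClass M C (fun x => A x ∧ B x) := by
  have hc' : ∀ n, c n ∈ C := fun n => hc ▸ ⟨n, rfl⟩
  have h₀ : IsTerm c (fun e => e (.set 0)) := .var _ fun _ => rfl
  obtain ⟨Y, hY, h⟩ := hA
  obtain ⟨Z, hZ, h'⟩ := hB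
  obtain ⟨W, hW, H⟩ := Definable.hasClass hMK hc' (A := fun x => x ∈ Y ∧ x ∈ Z)
    (.and (.mem h₀ (.param (hc.symm ▸ hY))) (.mem h₀ (.param (hc.symm ▸ hZ))))
  exact ⟨W, hW, fun x hx => (H x hx).trans (and_congr (h x hx) (h' x hx))⟩

theorem HasClass.or (hMK : IsMKModel M C) (hc : Set.range c = C)
    (hA : HasClass M C A) (hB : HasClass M C B) : HasClass M C (fun x => A x ∨ B x) := by
  have hc' : ∀ n, c n ∈ C := fun n => hc ▸ ⟨n, rfl⟩
  have h₀ : IsTerm c (fun e => e (.set 0)) := .var _ fun _ => rfl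
  obtain ⟨Y, hY, h⟩ := hA
  obtain ⟨Z, hZ, h'⟩ := hB
  obtain ⟨W, hW, H⟩ := Definable.hasClass hMK hc' (A := fun x => x ∈ Y ∨ x ∈ Z)
    (.or (.mem h₀ (.param (hc.symm ▸ hY))) (.mem h₀ (.param (hc.symm ▸ hZ))))
  exact ⟨W, hW, fun x hx => (H x hx).trans (or_congr (h x hx) (h' x hx))⟩

/-- The conditions that exclude an instance of a family, or lie in all its members, are dense; so
if `G` meets all members it contains a condition lying in all of them. -/
theorem Decides.forall (hMK : IsMKModel M C) (hc : Set.range c = C) (hP : IsForcing C P le)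
    (hG : IsGeneric C P le G) (hne : ∃ p, p ∈ G) {ι : Type*} {A : ι → ZFSet.{u} → Prop}
    {X : ι → Prop} (h : ∀ i, IsRegular le (A i)) (hX : ∀ i, (∃ p ∈ G, A i p) ↔ X i)
    (hA : HasClass M C (fun p => ∀ i, A i p))
    (hA' : HasClass M C (fun p => ∃ i, ClassForcing.starNeg le (A i) p)) :
    Decides M C le G (fun p => ∀ i, A i p) (∀ i, X i) := by
  refine ⟨.forall h, hA, fun ⟨p, hp, H⟩ i => (hX i).1 ⟨p, hp, H i⟩, fun H => ?_⟩
  obtain ⟨p, hp⟩ := hne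
  obtain ⟨q, hq, hq' | ⟨i, hi⟩⟩ := hG.exists_of_denseBelow hMK hc hP (hA.or hMK hc hA') hp (by
    intro q hqp
    by_cases hq : ∀ i, A i q
    · exact ⟨q, hP.refl q (hP.mem_left hqp), .inl hq⟩
    · push Not at hq
      obtain ⟨i, hi⟩ := hq
      obtain ⟨r, hrq, hr⟩ := (h i).exists_starNeg hi
      exact ⟨r, hrq, .inr ⟨i, hr⟩⟩)
  · exact ⟨q, hq, hq'⟩
  · obtain ⟨r, hr, hAr⟩ := (hX i).2 (H i)
    obtain ⟨s, hs, hsq, hsr⟩ := hG.directed hMK hc hP hq hr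
    exact absurd ((h i).down r s hsr hAr) (hi s hsq)

theorem Decides.starAnd (hMK : IsMKModel M C) (hc : Set.range c = C) (hP : IsForcing C P le)
    (hG : IsGeneric C P le G) (hA : Decides M C le G A X) (hB : Decides M C le G B Y) :
    Decides M C le G (starAnd A B) (X ∧ Y) := by
  refine ⟨hA.regular.starAnd hB.regular, hA.hasClass.and hMK hc hB.hasClass, ?_⟩
  rw [← hA.iff, ← hB.iff]
  constructor
  · rintro ⟨p, hp, h₁, h₂⟩
    exact ⟨⟨p, hp, h₁⟩, ⟨p, hp, h₂⟩⟩
  · rintro ⟨⟨p, hp, h₁⟩, ⟨q, hq, h₂⟩⟩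
    obtain ⟨r, hr, hrp, hrq⟩ := hG.directed hMK hc hP hp hq
    exact ⟨r, hr, hA.regular.down p r hrp h₁, hB.regular.down q r hrq h₂⟩

/-- By regularity, the conditions in `A` or in its negation are dense, so `G` meets one of the two;
directedness excludes both. -/
theorem Decides.starNeg (hMK : IsMKModel M C) (hc : Set.range c = C) (hP : IsForcing C P le)
    (hG : IsGeneric C P le G) (hne : ∃ p, p ∈ G) (hA : Decides M C le G A X) :
    Decides M C le G (starNeg le A) (¬ X) := by
  have hn := hA.hasClass.starNeg hMK hc hP.le_mem
  refine ⟨hA.regular.starNeg hP, hn, ?_⟩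
  rw [← hA.iff]
  constructor
  · rintro ⟨p, hp, h⟩ ⟨q, hq, h'⟩
    obtain ⟨r, hr, hrp, hrq⟩ := hG.directed hMK hc hP hp hq
    exact h r hrp (hA.regular.down q r hrq h')
  · intro h
    obtain ⟨p, hp⟩ := hne
    obtain ⟨q, hq, hq' | hq'⟩ := hG.exists_of_denseBelow hMK hc hP (hA.hasClass.or hMK hc hn) hp (by
      intro q hqp
      by_cases hq : A q
      · exact ⟨q, hP.refl q (hP.mem_left hqp), .inl hq⟩
      · obtain ⟨r, hrq, hr⟩ := hA.regular.exists_starNeg hq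
        exact ⟨r, hrq, .inr hr⟩)
    · exact absurd ⟨q, hq, hq'⟩ h
    · exact ⟨q, hq, hq'⟩

theorem Decides.starIff (hMK : IsMKModel M C) (hc : Set.range c = C) (hP : IsForcing C P le)
    (hG : IsGeneric C P le G) (hne : ∃ p, p ∈ G) (hA : Decides M C le G A X)
    (hB : Decides M C le G B Y) : Decides M C le G (starIff le A B) (X ↔ Y) := by
  have h := Decides.starAnd hMK hc hP hG
    (.starNeg hMK hc hP hG hne (.starAnd hMK hc hP hG hA (.starNeg hMK hc hP hG hne hB)))
    (.starNeg hMK hc hP hG hne (.starAnd hMK hc hP hG hB (.starNeg hMK hc hP hG hne hA)))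
  exact ⟨h.regular, h.hasClass, h.iff.trans (by tauto)⟩

variable {σ γ : ZFSet.{u}}

theorem hasClass_starMem (hMK : IsMKModel M C) (hc : Set.range c = C) (hle : le ∈ C)
    (hσ : σ ∈ C) (hγ : γ ∈ C) : HasClass M C (StarMem le σ γ) :=
  Definable.hasClass hMK (fun n => hc ▸ ⟨n, rfl⟩) (.starMem hMK hc hle (.param (hc.symm ▸ hσ))
    (.param (hc.symm ▸ hγ)) (.var (.set 0) fun _ => rfl))

theorem hasClass_starEq (hMK : IsMKModel M C) (hc : Set.range c = C) (hle : le ∈ C)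
    (hσ : σ ∈ C) (hγ : γ ∈ C) : HasClass M C (StarEq le σ γ) :=
  Definable.hasClass hMK (fun n => hc ▸ ⟨n, rfl⟩) (.starEq hMK hc hle (.param (hc.symm ▸ hσ))
    (.param (hc.symm ▸ hγ)) (.var (.set 0) fun _ => rfl))

/-- The inductive step from equality to membership. A condition in `G` met by the dense class
supplies `⟨π, r⟩` with `r ∈ G` by upward closure; conversely, a common lower bound of `r` and a
condition star-forcing the equality works. -/
theorem decides_starMem_of_starEq (hMK : IsMKModel M C) (hc : Set.range c = C)
    (hP : IsForcing C P le) (hG : IsGeneric C P le G) (hσ : σ ∈ C) (hγ : γ ∈ C)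
    (h : ∀ π r, ZFSet.pair π r ∈ γ →
      Decides M C le G (StarEq le π σ) (interp G π = interp G σ)) :
    Decides M C le G (StarMem le σ γ) (interp G σ ∈ interp G γ) := by
  have hc' : ∀ n, c n ∈ C := fun n => hc ▸ ⟨n, rfl⟩
  have hr : ∀ {x}, x ∈ C → x ∈ Set.range c := fun h => hc.symm ▸ h
  refine ⟨isRegular_starMem hP σ γ, hasClass_starMem hMK hc hP.le_mem hσ hγ, ?_⟩
  rw [mem_interp, starMem_eq]
  constructor
  · rintro ⟨p, hp, hd⟩
    obtain ⟨q, hq, π, r, hπ, hqr, hqe⟩ := hG.exists_of_denseBelow hMK hc hP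
      (Definable.hasClass hMK hc' (.exists_pair_mem hMK hc' (.param (hr hγ)) (.and
        (.pair_mem hMK hc' (.var (.set 2) fun _ => rfl) (.var (.set 0) fun _ => rfl)
          (.param (hr hP.le_mem)))
        (.starEq hMK hc hP.le_mem (.var (.set 1) fun _ => rfl) (.param (hr hσ))
          (.var (.set 2) fun _ => rfl))))) hp hd
    exact ⟨π, ⟨r, hG.upward_closed r (hP.mem_right hqr) q hq hqr, hπ⟩,
      (h π r hπ).iff.1 ⟨q, hq, hqe⟩⟩
  · rintro ⟨π, ⟨r, hr, hπ⟩, he⟩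
    obtain ⟨q, hq, hqe⟩ := (h π r hπ).iff.2 he
    obtain ⟨s, hs, hsq, hsr⟩ := hG.directed hMK hc hP hq hr
    refine ⟨s, hs, fun t hts => ⟨t, hP.refl t (hP.mem_left hts), π, r, hπ,
      hP.trans _ _ _ hts hsr, ?_⟩⟩
    exact (h π r hπ).regular.down q t (hP.trans _ _ _ hts hsq) hqe

end Truth

end ClassForcing

namespace ClassForcing

-- The truth lemma for equality and for all formulas.

section TruthLemma

variable {M C : Set ZFSet.{u}} {c : ℕ → ZFSet.{u}} {P le G σ γ : ZFSet.{u}}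

/-- Extensionality tested on all names occurring in `σ ∪ γ`, whether or not their conditions lie in
`G`: this mirrors the star-clause and presents equality as a family for `Decides.forall`. -/
theorem interp_eq_interp_iff : interp G σ = interp G γ ↔
    ∀ i : {x : ZFSet.{u} × ZFSet.{u} // ZFSet.pair x.1 x.2 ∈ σ ∪ γ},
      (interp G i.1.1 ∈ interp G σ ↔ interp G i.1.1 ∈ interp G γ) := by
  refine ⟨fun h i => by rw [h], fun h => ?_⟩
  ext x
  constructor
  · intro hx
    obtain ⟨τ, ⟨p, -, hτ⟩, rfl⟩ := mem_interp.1 hx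
    exact (h ⟨(τ, p), ZFSet.mem_union.2 (.inl hτ)⟩).1 hx
  · intro hx
    obtain ⟨τ, ⟨p, -, hτ⟩, rfl⟩ := mem_interp.1 hx
    exact (h ⟨(τ, p), ZFSet.mem_union.2 (.inr hτ)⟩).2 hx

/-- Equality is a possibly class-sized conjunction, so beyond the rank induction one needs the
conditions refuting some conjunct to form a class. -/
theorem decides_starEq (hMK : IsMKModel M C) (hc : Set.range c = C) (hP : IsForcing C P le)
    (hG : IsGeneric C P le G) (hne : ∃ p, p ∈ G) (hσ : σ ∈ C) (hγ : γ ∈ C) :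
    Decides M C le G (StarEq le σ γ) (interp G σ = interp G γ) := by
  induction hn : max σ.rank γ.rank using WellFoundedLT.induction generalizing σ γ with
  | _ n ih =>
  have hc' : ∀ n, c n ∈ C := fun n => hc ▸ ⟨n, rfl⟩
  have hr : ∀ {x}, x ∈ C → x ∈ Set.range c := fun h => hc.symm ▸ h
  have h₀ : IsTerm c (fun e => e (.set 0)) := .var _ fun _ => rfl
  have hM : ∀ {π r}, ZFSet.pair π r ∈ σ ∪ γ → π ∈ C := fun h =>
    hMK.mem_cls_of_mem ((ZFSet.mem_union.1 h).elim
      (fun h => (hMK.of_pair_mem_of_mem (.inr hσ) h).1)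
      (fun h => (hMK.of_pair_mem_of_mem (.inr hγ) h).1))
  have hpred : ∀ π r, ZFSet.pair π r ∈ σ ∪ γ → ∀ π' r', ZFSet.pair π' r' ∈ σ ∪ γ →
      Decides M C le G (StarEq le π' π) (interp G π' = interp G π) := fun π r hπ π' r' hπ' =>
    ih _ (hn ▸ max_rank_lt_of_pair_mem_union hπ hπ') (hM hπ') (hM hπ) rfl
  have hclause : StarEq le σ γ =
      fun p => ∀ i : {x : ZFSet.{u} × ZFSet.{u} // ZFSet.pair x.1 x.2 ∈ σ ∪ γ},
        starIff le (StarMem le i.1.1 σ) (StarMem le i.1.1 γ) p := by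
    funext p
    rw [StarEq]
    exact propext ⟨fun h i => h _ _ i.2, fun h π r hπ => h ⟨(π, r), hπ⟩⟩
  have hdec : ∀ i : {x : ZFSet.{u} × ZFSet.{u} // ZFSet.pair x.1 x.2 ∈ σ ∪ γ},
      Decides M C le G (starIff le (StarMem le i.1.1 σ) (StarMem le i.1.1 γ))
        (interp G i.1.1 ∈ interp G σ ↔ interp G i.1.1 ∈ interp G γ) := fun i =>
    .starIff hMK hc hP hG hne
      (decides_starMem_of_starEq hMK hc hP hG (hM i.2) hσ
        fun π' r' h => hpred _ _ i.2 π' r' (ZFSet.mem_union.2 (.inl h)))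
      (decides_starMem_of_starEq hMK hc hP hG (hM i.2) hγ
        fun π' r' h => hpred _ _ i.2 π' r' (ZFSet.mem_union.2 (.inr h)))
  have hcl := hasClass_starEq hMK hc hP.le_mem hσ hγ
  rw [hclause] at hcl
  rw [hclause, interp_eq_interp_iff]
  refine .forall hMK hc hP hG hne (fun i => (hdec i).regular) (fun i => (hdec i).iff) hcl ?_
  -- The existential is written as a negated universal to match `forall_pair_mem_union`.
  have hdef : HasClass M C (fun p => ¬ ∀ π r, ZFSet.pair π r ∈ σ ∪ γ →
      ¬ starNeg le (starIff le (StarMem le π σ) (StarMem le π γ)) p) := by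
    refine Definable.hasClass hMK hc' (.not (.forall_pair_mem_union hMK hc' (.param (hr hσ))
      (.param (hr hγ)) (.not (.starNeg hMK hc' (hr hP.le_mem) (.var (.set 2) fun _ => rfl)
      (A := fun e => starIff le (StarMem le (e (.set 1)) σ) (StarMem le (e (.set 1)) γ)) ?_))))
    exact .starIff hMK hc' (hr hP.le_mem) h₀
      (A := fun e => StarMem le (e (.set 2)) σ) (B := fun e => StarMem le (e (.set 2)) γ)
      (.starMem hMK hc hP.le_mem (.var (.set 3) fun _ => rfl) (.param (hr hσ)) h₀)
      (.starMem hMK hc hP.le_mem (.var (.set 3) fun _ => rfl) (.param (hr hγ)) h₀)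
  obtain ⟨Y, hY, h⟩ := hdef
  refine ⟨Y, hY, fun x hx => (h x hx).trans ⟨fun h => ?_, fun ⟨i, hi⟩ h => h _ _ i.2 hi⟩⟩
  push Not at h
  obtain ⟨π, r, hπ, h⟩ := h
  exact ⟨⟨(π, r), hπ⟩, h⟩

theorem decides_starMem (hMK : IsMKModel M C) (hc : Set.range c = C) (hP : IsForcing C P le)
    (hG : IsGeneric C P le G) (hne : ∃ p, p ∈ G) (hσ : σ ∈ C) (hγ : γ ∈ C) :
    Decides M C le G (StarMem le σ γ) (interp G σ ∈ interp G γ) :=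
  decides_starMem_of_starEq hMK hc hP hG hσ hγ fun _ _ hπ =>
    decides_starEq hMK hc hP hG hne
      (hMK.mem_cls_of_mem (hMK.of_pair_mem_of_mem (.inr hγ) hπ).1) hσ

theorem IsAssignment.of_names (hMK : IsMKModel M C) (hc : Set.range c = C)
    {v : Var → ZFSet.{u}} (hv : IsAssignment (setNames M P) (classNames M C P) v) :
    IsAssignment M C v :=
  ⟨fun n => setNames_subset hMK hc (hv.1 n), fun n => (hv.2 n).1⟩

theorem hasClass_forcesStar (hMK : IsMKModel M C) (hc : Set.range c = C) (hP : IsForcing C P le)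
    (φ : Formula) {v : Var → ZFSet.{u}}
    (hv : IsAssignment (setNames M P) (classNames M C P) v) :
    HasClass M C (ForcesStar M C P le φ v) :=
  Definable.comprehension hMK (fun n => hc ▸ ⟨n, rfl⟩) (Q := ForcesStar M C P le φ)
    (.forcesStar hMK hc hP.carrier_mem hP.le_mem φ (Var.map (· + 1) id)
      (.var (.set 0) fun _ => rfl)) (hv.of_names hMK hc)

/-- Supplies the class of refuting conditions that `Decides.forall` requires in the quantifier step.
-/
theorem hasClass_exists_set_starNeg (hMK : IsMKModel M C) (hc : Set.range c = C)
    (hP : IsForcing C P le) (φ : Formula) (n : ℕ) {v : Var → ZFSet.{u}}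
    (hv : IsAssignment (setNames M P) (classNames M C P) v) :
    HasClass M C (fun p => ∃ i : {σ // σ ∈ setNames M P},
      starNeg le (ForcesStar M C P le φ (Function.update v (.set n) i.1)) p) := by
  have hc' : ∀ n, c n ∈ C := fun n => hc ▸ ⟨n, rfl⟩
  obtain ⟨Y, hY, h⟩ := Definable.comprehension hMK hc' (Q := fun v p => ∃ σ ∈ M, σ ∈ setNames M P ∧
      starNeg le (ForcesStar M C P le φ (Function.update v (.set n) σ)) p)
    (.exSet (.and (.mem_setNames hMK hc hP.carrier_mem 0)
      (.starNeg hMK hc' (hc.symm ▸ hP.le_mem) (.var (.set 1) fun _ => rfl)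
        (A := fun e => ForcesStar M C P le φ
          (Function.update (tailSet (tailSet e)) (.set n) (e (.set 0))))
        ((Definable.forcesStar hMK hc hP.carrier_mem hP.le_mem φ
          -- Three sets lie on top of the original stack: the condition `q` of the negation clause,
          -- the name `σ` at position `1`, and `p`.
          (Function.update (Var.map (· + 3) id) (.set n) (.set 1))
          (.var (.set 0) fun _ => rfl)).congr fun e _ => by
            rw [show (fun a => e (Function.update (Var.map (· + 3) id) (.set n) (.set 1) a)) =
              _ from Function.comp_update e _ _ _,
              show e ∘ Var.map (· + 3) id = tailSet (tailSet (tailSet e)) by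
                funext a; cases a <;> rfl]
            rfl)))) (hv.of_names hMK hc)
  refine ⟨Y, hY, fun x hx => (h x hx).trans ⟨?_, ?_⟩⟩
  · rintro ⟨σ, -, hσ, h⟩
    exact ⟨⟨σ, hσ⟩, h⟩
  · rintro ⟨⟨σ, hσ⟩, h⟩
    exact ⟨σ, setNames_subset hMK hc hσ, hσ, h⟩

theorem hasClass_exists_cls_starNeg (hMK : IsMKModel M C) (hc : Set.range c = C)
    (hP : IsForcing C P le) (φ : Formula) (n : ℕ) {v : Var → ZFSet.{u}}
    (hv : IsAssignment (setNames M P) (classNames M C P) v) :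
    HasClass M C (fun p => ∃ i : {S // S ∈ classNames M C P},
      starNeg le (ForcesStar M C P le φ (Function.update v (.cls n) i.1)) p) := by
  have hc' : ∀ n, c n ∈ C := fun n => hc ▸ ⟨n, rfl⟩
  obtain ⟨Y, hY, h⟩ := Definable.comprehension hMK hc'
    (Q := fun v p => ∃ S ∈ C, S ∈ classNames M C P ∧
      starNeg le (ForcesStar M C P le φ (Function.update v (.cls n) S)) p)
    (.exCls (.and (.mem_classNames hMK hc hP.carrier_mem 0)
      (.starNeg hMK hc' (hc.symm ▸ hP.le_mem) (.var (.set 0) fun _ => rfl)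
        (A := fun e => ForcesStar M C P le φ
          (Function.update (tailSet (tailCls e)) (.cls n) (e (.cls 0))))
        ((Definable.forcesStar hMK hc hP.carrier_mem hP.le_mem φ
          -- Here `q` and `p` are on the set stack and `S` is alone on the class stack.
          (Function.update (Var.map (· + 2) (· + 1)) (.cls n) (.cls 0))
          (.var (.set 0) fun _ => rfl)).congr fun e _ => by
            rw [show (fun a => e (Function.update (Var.map (· + 2) (· + 1)) (.cls n) (.cls 0) a)) =
              _ from Function.comp_update e _ _ _,
              show e ∘ Var.map (· + 2) (· + 1) = tailSet (tailCls (tailSet e)) by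
                funext a; cases a <;> rfl]
            rfl)))) (hv.of_names hMK hc)
  refine ⟨Y, hY, fun x hx => (h x hx).trans ⟨?_, ?_⟩⟩
  · rintro ⟨S, -, hS, h⟩
    exact ⟨⟨S, hS⟩, h⟩
  · rintro ⟨⟨S, hS⟩, h⟩
    exact ⟨S, hS.1, hS, h⟩

/-- The truth lemma for star-forcing. -/
theorem decides_forcesStar (hMK : IsMKModel M C) (hc : Set.range c = C) (hP : IsForcing C P le)
    (hG : IsGeneric C P le G) (hne : ∃ p, p ∈ G) (φ : Formula) {v : Var → ZFSet.{u}}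
    (hv : IsAssignment (setNames M P) (classNames M C P) v) :
    Decides M C le G (ForcesStar M C P le φ v)
      (Sat (extSets M P G) (extClasses M C P G) φ (fun a => interp G (v a))) := by
  induction φ generalizing v with
  | mem a b =>
    have hvC : ∀ a, v a ∈ C := fun
      | .set n => hMK.mem_cls_of_mem ((hv.of_names hMK hc).1 n)
      | .cls n => (hv.of_names hMK hc).2 n
    exact decides_starMem hMK hc hP hG hne (hvC a) (hvC b)
  | eq a b =>
    have hvC : ∀ a, v a ∈ C := fun
      | .set n => hMK.mem_cls_of_mem ((hv.of_names hMK hc).1 n)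
      | .cls n => (hv.of_names hMK hc).2 n
    exact decides_starEq hMK hc hP hG hne (hvC a) (hvC b)
  | and φ ψ h₁ h₂ => exact .starAnd hMK hc hP hG (h₁ hv) (h₂ hv)
  | neg φ h => exact .starNeg hMK hc hP hG hne (h hv)
  | allSet n φ ih =>
    have h := Decides.forall hMK hc hP hG hne
      (fun i : {σ // σ ∈ setNames M P} => (ih (hv.updateSet i.2 n)).regular)
      (fun i => (ih (hv.updateSet i.2 n)).iff)
      (by
        have := hasClass_forcesStar hMK hc hP (.allSet n φ) hv
        simpa only [ForcesStar, Subtype.forall] using this)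
      (hasClass_exists_set_starNeg hMK hc hP φ n hv)
    simp only [Subtype.forall] at h
    refine ⟨h.regular, h.hasClass, h.iff.trans ?_⟩
    -- Elements of the extension are interpretations of names, so its quantifier becomes one over
    -- names.
    simp only [Sat, extSets, Set.mem_ofPred_eq, forall_exists_index, and_imp]
    rw [forall_comm]
    refine forall_congr' fun σ => ?_
    rw [show (fun a => interp G (Function.update v (.set n) σ a)) =
      _ from Function.comp_update (interp G) _ _ _]
    exact ⟨fun h x hσ hx => hx ▸ h hσ, fun h hσ => h _ hσ rfl⟩
  | allCls n φ ih =>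
    have h := Decides.forall hMK hc hP hG hne
      (fun i : {S // S ∈ classNames M C P} => (ih (hv.updateCls i.2 n)).regular)
      (fun i => (ih (hv.updateCls i.2 n)).iff)
      (by
        have := hasClass_forcesStar hMK hc hP (.allCls n φ) hv
        simpa only [ForcesStar, Subtype.forall] using this)
      (hasClass_exists_cls_starNeg hMK hc hP φ n hv)
    simp only [Subtype.forall] at h
    refine ⟨h.regular, h.hasClass, h.iff.trans ?_⟩
    simp only [Sat, extClasses, Set.mem_ofPred_eq, forall_exists_index, and_imp]
    rw [forall_comm]
    refine forall_congr' fun S => ?_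
    rw [show (fun a => interp G (Function.update v (.cls n) S a)) =
      _ from Function.comp_update (interp G) _ _ _]
    exact ⟨fun h x hS hx => hx ▸ h hS, fun h hS => h _ hS rfl⟩

theorem forcesStar_iff_forces (hMK : IsMKModel M C) (hc : Set.range c = C)
    (hP : IsForcing C P le) (φ : Formula) {v : Var → ZFSet.{u}}
    (hv : IsAssignment (setNames M P) (classNames M C P) v) {p : ZFSet.{u}} :
    ForcesStar M C P le φ v p ↔ Forces M C P le φ v p := by
  constructor
  · intro h G hG hp
    exact (decides_forcesStar hMK hc hP hG ⟨p, hp⟩ φ hv).iff.1 ⟨p, hp, h⟩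
  · intro h
    by_contra hn
    obtain ⟨q, hqp, hq⟩ := (isRegular_forcesStar hP φ v).exists_starNeg hn
    obtain ⟨G, hG, hqG⟩ := exists_isGeneric hc hP (hP.mem_left hqp)
    have hpG := hG.upward_closed p (hP.mem_right hqp) q hqG hqp
    -- The truth lemma for the negated formula contradicts what `p` forces.
    exact (decides_forcesStar hMK hc hP hG ⟨q, hqG⟩ (.neg φ) hv).iff.1 ⟨q, hqG, hq⟩ (h G hG hpG)

end TruthLemma

end ClassForcing

theorem lemma19 (M C : Set ZFSet.{u}) (hMK : ClassForcing.IsMKModel M C)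
    (hM : M.Countable) (hC : C.Countable)
    (P le : ZFSet.{u}) (hP : ClassForcing.IsForcing C P le)
    (φ : ClassForcing.Formula) (v : ClassForcing.Var → ZFSet.{u})
    (hv : ClassForcing.IsAssignment
      (ClassForcing.setNames M P) (ClassForcing.classNames M C P) v)
    (p : ZFSet.{u}) (hp : p ∈ P) :
    ClassForcing.ForcesStar M C P le φ v p ↔ ClassForcing.Forces M C P le φ v p := by
  -- The enumeration serves twice: as the stock of parameters for definability and as the list of
  -- dense classes to be met.
  obtain ⟨c, hc⟩ := hC.exists_eq_range hMK.exists_mem_cls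
  exact ClassForcing.forcesStar_iff_forces hMK hc.symm hP φ hv
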